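/- In the game $0.33$ on a connected finite graph, two players alternately remove one vertex or two adjacent vertices so that the remaining graph is empty or connected; the player who moves last wins. Let $\mathcal G$ denote the Grundy value and write $J_1\equiv J_2$ if the disjoint sum $J_1+J_2$ is a win for the second player. A subdivided star is either the empty graph $\emptyset$ or $S_{\ell_1,\dots,\ell_k}$ ($k\ge 0$, $\ell_i\ge 1$), a central vertex to which paths with $\ell_1,\dots,\ell_k$ vertices are attached. For subdivided stars $S,S'$, let $S\overset{2}{-}S'$ be the graph obtained by adding one new vertex and joining it to the central vertex of each nonempty one among $S,S'$. Write $S\sim_2 S'$ if $S\overset{2}{-}\hat S\equiv S'\overset{2}{-}\hat S$ for every subdivided star $\hat S$. The reduction of $S_{\ell_1,\dots,\ell_k}$ is the star obtained by replacing each $\ell_i$ by $\ell_i \bmod 3$ and dropping the paths of length $0$; $\emptyset$ is its own reduction. Let $t(S)$ be the number of paths of length $2$ in the reduction of $S$ (the number of $i$ with $\ell_i\equiv 2 \pmod 3$; $t(\emptyset)=0$), and let $P_1$, $P_2=S_1$ be the stars with $k=0$ and with $k=1,\ \ell_1=1$. Define the following sets of subdivided stars: - $\mathcal D_0^*$: $\mathcal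 G(S)=0$ and $t(S)\in\{0,2\}$, or the reduction of $S$ is $S_2$; - $\mathcal D_1^*$: the reduction of $S$ is $P_1$, $S_{2,1}$ or $S_{2,2,2}$; - $\mathcal D_1^{\Box}$: $\mathcal G(S)=1$, $t(S)\in\{0,2\}$ and the reduction of $S$ is not $P_1$; - $\mathcal D_2^*$: the reduction of $S$ is $P_2$ or $S_{2,2}$; - $\mathcal D_2^{\Box}$: $\mathcal G(S)=2$ and $t(S)\in\{1,3\}$; - $\mathcal D_3^{\Box}$: $\mathcal G(S)=3$ and $t(S)\in\{1,3\}$; - for $i\in\{0,1,2,3\}$, $\mathcal D_i$: $\mathcal G(S)=i$ and $S$ is in none of the six previous sets. Then $\sim_2$ is an equivalence relation, the ten sets $\mathcal D_0,\mathcal D_0^*,\mathcal D_1,\mathcal D_1^*,\mathcal D_1^{\Box},\mathcal D_2,\mathcal D_2^*,\mathcal D_2^{\Box},\mathcal D_3,\mathcal D_3^{\Box}$ are pairwise distinct, and they are exactly its equivalence classes. Moreover, $\mathcal G(S\overset{2}{-}S')$ is given by the following table, according to the class of $S$ (row) and of $S'$ (column), where $\oplus$ means $\mathcal G(S)\oplus\mathcal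 G(S')$ (nim-sum) and $\oplus_1$ means $\mathcal G(S)\oplus\mathcal G(S')\oplus 1$: $$\begin{array}{c|c|c|c|c|c|c|c|c|c|c} &\mathcal D_0 & \mathcal D_0^* & \mathcal D_1 & \mathcal D_1^* & \mathcal D_1^{\Box} & \mathcal D_2 & \mathcal D_2^* & \mathcal D_2^{\Box} & \mathcal D_3 & \mathcal D_3^{\Box} \\ \hline \mathcal D_0 & \oplus & \oplus_1 & \oplus & 2 & \oplus_1 & \oplus & 0 & \oplus_1 & \oplus & \oplus_1 \\ \mathcal D_0^* & \oplus_1 & \oplus_1 & \oplus_1 & 2 & \oplus_1 & \oplus_1 & 0 & \oplus_1 & \oplus_1 & \oplus_1 \\ \mathcal D_1 & \oplus & \oplus_1 & \oplus & 3 & \oplus_1 & \oplus & 1 & \oplus_1 & \oplus & \oplus_1 \\ \mathcal D_1^* & 2 & 2 & 3 & 0 & 3 & 0 & 1 & 1 & 1 & 0 \\ \mathcal D_1^{\Box} & \oplus_1 & \oplus_1 & \oplus_1 & 3 & \oplus_1 & \oplus_1 & 1 & \oplus_1 & \oplus_1 & \oplus_1 \\ \mathcal D_2 & \oplus & \oplus_1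 & \oplus & 0 & \oplus_1 & \oplus & 2 & \oplus_1 & \oplus & \oplus_1 \\ \mathcal D_2^* & 0 & 0 & 1 & 1 & 1 & 2 & 2 & 2 & 3 & 3 \\ \mathcal D_2^{\Box} & \oplus_1 & \oplus_1 & \oplus_1 & 1 & \oplus_1 & \oplus_1 & 2 & 0 & \oplus_1 & 1 \\ \mathcal D_3 & \oplus & \oplus_1 & \oplus & 1 & \oplus_1 & \oplus & 3 & \oplus_1 & \oplus & \oplus_1 \\ \mathcal D_3^{\Box} & \oplus_1 & \oplus_1 & \oplus_1 & 0 & \oplus_1 & \oplus_1 & 3 & 1 & \oplus_1 & 0 \end{array}$$ -/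

import Mathlib

/-! ### Impartial games in normal play

A game is given by a relation `opt` on positions, `opt q p` meaning that `q` is an option of `p`. -/

/-- `PPosition opt p`: the second player wins from `p`, i.e. every move from `p` has a reply leading
to a position of the same kind. -/
inductive PPosition {P : Type*} (opt : P → P → Prop) : P → Prop
  | intro (p : P) (reply : ∀ q, opt q p → P)
      (legal : ∀ q (h : opt q p), opt (reply q h) q)
      (wins : ∀ q (h : opt q p), PPosition opt (reply q h)) : PPosition opt p

/-- The smallest nonnegative integer not in `s`. -/
noncomputable def mex (s : Set ℕ) : ℕ := sInf sᶜ

/-- The Grundy value: the mex of the Grundy values of the options. -/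
noncomputable def grundy {P : Type*} (opt : P → P → Prop) [IsWellFounded P opt] : P → ℕ :=
  IsWellFounded.fix opt fun p g => mex {n | ∃ q, ∃ h : opt q p, g q h = n}

/-! ### The game 0.33 on a connected graph -/

/-- Positions of the game 0.33 on a connected graph `G` are the sets of remaining vertices.
`OctalMove G W' W`: one passes from `W` to `W'` by removing a set `X` made of one vertex or of two
adjacent vertices, so that the remaining graph is not disconnected (it may be empty). -/
def OctalMove {V : Type*} [DecidableEq V] (G : SimpleGraph V) (W' W : Finset V) : Prop :=
  ∃ X ⊆ W, (X.card = 1 ∨ X.card = 2) ∧ (G.induce (X : Set V)).Connected ∧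
    W' = W \ X ∧ (G.induce (W' : Set V)).Preconnected

instance OctalMove.isWellFounded {V : Type*} [DecidableEq V] (G : SimpleGraph V) :
    IsWellFounded (Finset V) (OctalMove G) where
  wf := by
    refine Subrelation.wf (r := fun A B : Finset V => A.card < B.card) ?_
      (measure Finset.card).wf
    rintro W' W ⟨X, hXW, hX, -, rfl, -⟩
    have h := Finset.card_sdiff_add_card_eq_card hXW
    show (W \ X).card < W.card
    omega

/-- The Grundy value of the game 0.33 played on the graph `G`. -/
noncomputable def grundyValue {V : Type*} [DecidableEq V] [Fintype V] (G : SimpleGraph V) : ℕ :=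
  grundy (OctalMove G) Finset.univ

/-- `G ≡ H`: the disjoint sum of the games 0.33 on `G` and on `H` is a P-position. -/
def GameEquiv {V V' : Type*} [DecidableEq V] [Fintype V] [DecidableEq V'] [Fintype V']
    (G : SimpleGraph V) (H : SimpleGraph V') : Prop :=
  PPosition (Prod.GameAdd (OctalMove G) (OctalMove H)) (Finset.univ, Finset.univ)

/-! ### Subdivided stars -/

/-- A subdivided star: either the empty graph or `S_{ℓ₁,…,ℓₖ}` with `k ≥ 0` and all `ℓᵢ ≥ 1`, made of
a central vertex to which paths with `ℓ₁, …, ℓₖ` vertices are attached. -/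
inductive SubdividedStar : Type
  | empty : SubdividedStar
  | star (paths : List ℕ) (pos : ∀ l ∈ paths, 1 ≤ l) : SubdividedStar

namespace SubdividedStar

/-- The vertices: `none` is the central vertex, and `some ⟨i, j⟩` is the vertex at distance `j + 1`
from the centre on the path number `i`. -/
def Vertex : SubdividedStar → Type
  | empty => Empty
  | star paths _ => Option ((i : Fin paths.length) × Fin (paths.get i))

instance : (S : SubdividedStar) → DecidableEq S.Vertex
  | empty => inferInstanceAs (DecidableEq Empty)
  | star paths _ => inferInstanceAs (DecidableEq (Option ((i : Fin paths.length) × Fin (paths.get i))))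

instance : (S : SubdividedStar) → Fintype S.Vertex
  | empty => inferInstanceAs (Fintype Empty)
  | star paths _ => inferInstanceAs (Fintype (Option ((i : Fin paths.length) × Fin (paths.get i))))

/-- `v` is the central vertex. -/
def IsCenter : (S : SubdividedStar) → S.Vertex → Prop
  | empty, _ => False
  | star _ _, v => v = none

/-- `Step S u v`: `v` is the neighbour of `u` that is farther from the centre. -/
def Step : (S : SubdividedStar) → S.Vertex → S.Vertex → Prop
  | empty, _, _ => False
  | star _ _, none, some ⟨_, j⟩ => j.val = 0
  | star _ _, some ⟨i, j⟩, some ⟨i', j'⟩ => i = i' ∧ j'.val = j.val + 1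
  | star _ _, _, none => False

/-- The subdivided star as a graph. -/
def graph (S : SubdividedStar) : SimpleGraph S.Vertex := SimpleGraph.fromRel S.Step

/-- One half of the adjacency of the bistar; `Sum.inr (Sum.inl ())` is the middle vertex. -/
def BistarStep (S S' : SubdividedStar) :
    S.Vertex ⊕ Unit ⊕ S'.Vertex → S.Vertex ⊕ Unit ⊕ S'.Vertex → Prop
  | Sum.inl u, Sum.inl v => S.graph.Adj u v
  | Sum.inr (Sum.inr u), Sum.inr (Sum.inr v) => S'.graph.Adj u v
  | Sum.inr (Sum.inl _), Sum.inl v => S.IsCenter v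
  | Sum.inr (Sum.inl _), Sum.inr (Sum.inr v) => S'.IsCenter v
  | _, _ => False

/-- The subdivided bistar whose middle path has two edges: the central vertices of `S` and `S'` are
joined through one middle vertex. If `S'` is empty, this is `S` with one more path, with one vertex,
attached to its centre; if both are empty, it is a single vertex. -/
def bistar (S S' : SubdividedStar) : SimpleGraph (S.Vertex ⊕ Unit ⊕ S'.Vertex) :=
  SimpleGraph.fromRel (BistarStep S S')

/-- The relation `S ∼₂ S'`. -/
def Sim2 (S S' : SubdividedStar) : Prop :=
  ∀ T : SubdividedStar, GameEquiv (S.bistar T) (S'.bistar T)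

/-- The Grundy value of the subdivided star. -/
noncomputable def value (S : SubdividedStar) : ℕ := grundyValue S.graph

/-- After reducing all path lengths modulo 3 and dropping the paths that become empty, `S` is
the (nonempty) star whose paths have the given lengths. -/
def ReducesTo : SubdividedStar → Multiset ℕ → Prop
  | empty, _ => False
  | star paths _, m => (((paths.map (· % 3)).filter (· ≠ 0) : List ℕ) : Multiset ℕ) = m

/-- The number of paths of length 2 after reduction of all path lengths modulo 3. -/
def numTwo : SubdividedStar → ℕ
  | empty => 0
  | star paths _ => (paths.map (· % 3)).count 2

end SubdividedStar

/-! ### The ten classes and the table -/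

/-- Names of the classes; the suffixes `s` and `b` stand for star and box. -/
inductive StarClass : Type
  | d0 | d0s | d1 | d1s | d1b | d2 | d2s | d2b | d3 | d3b

namespace StarClass

open SubdividedStar

/-- The six special classes (`False` for the four others). -/
def Special : StarClass → SubdividedStar → Prop
  | d0s, S => (S.value = 0 ∧ (S.numTwo = 0 ∨ S.numTwo = 2)) ∨ S.ReducesTo {2}
  | d1s, S => S.ReducesTo 0 ∨ S.ReducesTo {2, 1} ∨ S.ReducesTo {2, 2, 2}
  | d1b, S => S.value = 1 ∧ (S.numTwo = 0 ∨ S.numTwo = 2) ∧ ¬ S.ReducesTo 0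
  | d2s, S => S.ReducesTo {1} ∨ S.ReducesTo {2, 2}
  | d2b, S => S.value = 2 ∧ (S.numTwo = 1 ∨ S.numTwo = 3)
  | d3b, S => S.value = 3 ∧ (S.numTwo = 1 ∨ S.numTwo = 3)
  | _, _ => False

/-- The ten classes as sets of subdivided stars. -/
def stars : StarClass → Set SubdividedStar
  | d0 => {S | S.value = 0 ∧ ∀ c, ¬ Special c S}
  | d1 => {S | S.value = 1 ∧ ∀ c, ¬ Special c S}
  | d2 => {S | S.value = 2 ∧ ∀ c, ¬ Special c S}
  | d3 => {S | S.value = 3 ∧ ∀ c, ¬ Special c S}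
  | c => {S | Special c S}

/-- An entry of the table: a function of the Grundy values of the two stars. -/
abbrev Entry : Type := ℕ → ℕ → ℕ

/-- The nim-sum. -/
def X : Entry := fun x y => x ^^^ y

/-- The nim-sum, nim-added to 1. -/
def Y : Entry := fun x y => x ^^^ y ^^^ 1

/-- A constant entry. -/
def K (n : ℕ) : Entry := fun _ _ => n

/-- A row of the table, with columns ordered as the constructors of `StarClass`. -/
def row (e0 e0s e1 e1s e1b e2 e2s e2b e3 e3b : Entry) : StarClass → Entry
  | d0 => e0
  | d0s => e0s
  | d1 => e1
  | d1s => e1s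
  | d1b => e1b
  | d2 => e2
  | d2s => e2s
  | d2b => e2b
  | d3 => e3
  | d3b => e3b

/-- The table giving the Grundy value of the bistar. -/
def table : StarClass → StarClass → Entry
  --            d0    d0s   d1    d1s   d1b   d2    d2s   d2b   d3    d3b
  | d0  => row  X     Y     X     (K 2) Y     X     (K 0) Y     X     Y
  | d0s => row  Y     Y     Y     (K 2) Y     Y     (K 0) Y     Y     Y
  | d1  => row  X     Y     X     (K 3) Y     X     (K 1) Y     X     Y
  | d1s => row  (K 2) (K 2) (K 3) (K 0) (K 3) (K 0) (K 1) (K 1) (K 1) (K 0)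
  | d1b => row  Y     Y     Y     (K 3) Y     Y     (K 1) Y     Y     Y
  | d2  => row  X     Y     X     (K 0) Y     X     (K 2) Y     X     Y
  | d2s => row  (K 0) (K 0) (K 1) (K 1) (K 1) (K 2) (K 2) (K 2) (K 3) (K 3)
  | d2b => row  Y     Y     Y     (K 1) Y     Y     (K 2) (K 0) Y     (K 1)
  | d3  => row  X     Y     X     (K 1) Y     X     (K 3) Y     X     Y
  | d3b => row  Y     Y     Y     (K 0) Y     Y     (K 3) (K 1) Y     (K 0)

end StarClass

/-!
Root a bistar at its middle vertex. A connected induced subgraph minus a move is a branch, i.e. a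
vertex together with its descendants, or the complement of a branch; so a move cuts the tree at one
edge and removes a part that has one or two vertices. The positions that arise are paths, stars and
bistars, and the game becomes a game on lengths of paths.

For stars and bistars the values depend only on the numbers `a` and `b` of paths of length 1 and 2
modulo 3, through a class that is eventually 2-periodic in `a` and `b`. By induction on the number
of vertices, everything reduces to a finite statement about the classes: the options of a star are
obtained by replacing one residue modulo 3 by the two others, and neither they nor the same moves in
a bistar keep the value, while every smaller value is reached. The classes are told apart by the
columns of the table, which turns the equality of the Grundy values of all bistars into the equality
of the classes.
-/

/-! ### Grundy values -/

theorem mex_eq_of_forall {s : Set ℕ} {v : ℕ} (hv : v ∉ s) (hlt : ∀ u < v, u ∈ s) : mex s = v :=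
  le_antisymm (Nat.sInf_le hv) <| le_csInf ⟨v, hv⟩ fun u hu => not_lt.1 fun h => hu (hlt u h)

theorem mex_notMem {s : Set ℕ} (hs : s.Finite) : mex s ∉ s :=
  Nat.sInf_mem (s := sᶜ) hs.infinite_compl.nonempty

theorem mem_of_lt_mex {s : Set ℕ} {u : ℕ} (hu : u < mex s) : u ∈ s :=
  not_not.1 (Nat.notMem_of_lt_sInf (s := sᶜ) hu)

section Grundy

variable {P Q : Type*} {opt : P → P → Prop} {opt' : Q → Q → Prop}

theorem grundy_eq_mex [IsWellFounded P opt] (p : P) :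
    grundy opt p = mex {n | ∃ q, opt q p ∧ grundy opt q = n} := by
  rw [grundy, IsWellFounded.fix_eq]
  simp only [exists_prop]

theorem grundy_eq_of_forall [IsWellFounded P opt] {g : P → ℕ}
    (hne : ∀ p q, opt q p → g q ≠ g p) (hex : ∀ p, ∀ u < g p, ∃ q, opt q p ∧ g q = u) (p : P) :
    grundy opt p = g p := by
  induction p using (IsWellFounded.wf : WellFounded opt).induction with
  | _ p ih =>
    rw [grundy_eq_mex]
    refine mex_eq_of_forall ?_ fun u hu => ?_
    · rintro ⟨q, hq, e⟩
      exact hne p q hq ((ih q hq).symm.trans e)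
    · obtain ⟨q, hq, e⟩ := hex p u hu
      exact ⟨q, hq, (ih q hq).trans e⟩

theorem grundy_ne_of_opt [IsWellFounded P opt] {p q : P} (fin : {r | opt r p}.Finite)
    (h : opt q p) : grundy opt q ≠ grundy opt p := by
  intro e
  refine mex_notMem (fin.image (grundy opt)) ⟨q, h, e.trans ?_⟩
  exact grundy_eq_mex p

theorem exists_opt_grundy_eq [IsWellFounded P opt] {p : P} {u : ℕ} (hu : u < grundy opt p) :
    ∃ q, opt q p ∧ grundy opt q = u :=
  mem_of_lt_mex (grundy_eq_mex (opt := opt) p ▸ hu)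

theorem grundy_eq_of_bisimulation [IsWellFounded P opt] [IsWellFounded Q opt'] {R : P → Q → Prop}
    (forth : ∀ {p q p'}, R p q → opt p' p → ∃ q', opt' q' q ∧ R p' q')
    (back : ∀ {p q q'}, R p q → opt' q' q → ∃ p', opt p' p ∧ R p' q')
    {p : P} {q : Q} (h : R p q) : grundy opt p = grundy opt' q := by
  induction p using (IsWellFounded.wf : WellFounded opt).induction generalizing q with
  | _ p ih =>
    rw [grundy_eq_mex, grundy_eq_mex]
    congr 1
    ext n
    constructor
    · rintro ⟨p', hp, rfl⟩
      obtain ⟨q', hq, h'⟩ := forth h hp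
      exact ⟨q', hq, (ih p' hp h').symm⟩
    · rintro ⟨q', hq, rfl⟩
      obtain ⟨p', hp, h'⟩ := back h hq
      exact ⟨p', hp, ih p' hp h'⟩

theorem pPosition_iff_of_kernel [IsWellFounded P opt] {K : P → Prop}
    (leave : ∀ p q, K p → opt q p → ¬ K q) (enter : ∀ p, ¬ K p → ∃ q, opt q p ∧ K q) (p : P) :
    PPosition opt p ↔ K p := by
  suffices h : (K p → PPosition opt p) ∧ (¬ K p → ∃ q, opt q p ∧ PPosition opt q) by
    refine ⟨fun hp => ?_, h.1⟩
    clear h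
    induction hp with
    | intro p reply legal _ ih =>
      by_contra hK
      obtain ⟨q, hq, hKq⟩ := enter p hK
      exact leave q _ hKq (legal q hq) (ih q hq)
  induction p using (IsWellFounded.wf : WellFounded opt).induction with
  | _ p ih =>
    constructor
    · intro hp
      choose reply legal wins using fun q (hq : opt q p) => (ih q hq).2 (leave p q hp hq)
      exact .intro p reply legal wins
    · intro hp
      obtain ⟨q, hq, hKq⟩ := enter p hp
      exact ⟨q, hq, (ih q hq).1 hKq⟩

theorem pPosition_gameAdd_iff [IsWellFounded P opt] [IsWellFounded Q opt']
    (fin : ∀ p, {r | opt r p}.Finite) (fin' : ∀ q, {r | opt' r q}.Finite) (z : P × Q) :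
    PPosition (Prod.GameAdd opt opt') z ↔ grundy opt z.1 = grundy opt' z.2 := by
  have : IsWellFounded (P × Q) (Prod.GameAdd opt opt') :=
    ⟨WellFounded.prod_gameAdd IsWellFounded.wf IsWellFounded.wf⟩
  refine pPosition_iff_of_kernel (K := fun z : P × Q => grundy opt z.1 = grundy opt' z.2)
    ?_ ?_ z
  · rintro ⟨p, q⟩ _ h (⟨hp⟩ | ⟨hq⟩) h'
    · exact grundy_ne_of_opt (fin p) hp (h'.trans h.symm)
    · exact grundy_ne_of_opt (fin' q) hq (h'.symm.trans h)
  · rintro ⟨p, q⟩ hne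
    rcases lt_or_gt_of_ne hne with h | h
    · obtain ⟨q', hq, e⟩ := exists_opt_grundy_eq h
      exact ⟨(p, q'), .snd hq, e.symm⟩
    · obtain ⟨p', hp, e⟩ := exists_opt_grundy_eq h
      exact ⟨(p', q), .fst hp, e⟩

end Grundy

section OctalMove

variable {V V' : Type*} {G : SimpleGraph V} {H : SimpleGraph V'}

theorem induce_map_iso (φ : G ↪g H) (W : Finset V) :
    Nonempty (G.induce (W : Set V) ≃g H.induce (W.map φ.toEmbedding : Set V')) := by
  rw [Finset.coe_map]
  exact ⟨{ toEquiv := Equiv.Set.image φ W φ.injective, map_rel_iff' := φ.map_adj_iff }⟩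

variable [DecidableEq V] [DecidableEq V']

theorem OctalMove.subset {W' W : Finset V} (h : OctalMove G W' W) : W' ⊆ W := by
  obtain ⟨X, -, -, -, rfl, -⟩ := h
  exact Finset.sdiff_subset

theorem OctalMove.finite (W : Finset V) : {W' | OctalMove G W' W}.Finite :=
  W.powerset.finite_toSet.subset fun _ h => Finset.mem_coe.2 (Finset.mem_powerset.2 h.subset)

theorem gameEquiv_iff [Fintype V] [Fintype V'] :
    GameEquiv G H ↔ grundyValue G = grundyValue H :=
  pPosition_gameAdd_iff OctalMove.finite OctalMove.finite _

theorem octalMove_map_iff (φ : G ↪g H) {W' W : Finset V} :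
    OctalMove H (W'.map φ.toEmbedding) (W.map φ.toEmbedding) ↔ OctalMove G W' W := by
  have preconnected (U : Finset V) := (induce_map_iso φ U).some.preconnected_iff
  constructor
  · rintro ⟨X, hX, hcard, hconn, e, hpre⟩
    obtain ⟨X, hXW, rfl⟩ := Finset.subset_map_iff.1 hX
    refine ⟨X, hXW, by simpa using hcard, (induce_map_iso φ X).some.connected_iff.2 hconn, ?_,
      (preconnected W').2 hpre⟩
    rwa [← Finset.map_sdiff, Finset.map_inj] at e
  · rintro ⟨X, hX, hcard, hconn, rfl, hpre⟩
    exact ⟨X.map φ.toEmbedding, Finset.map_subset_map.2 hX, by simpa using hcard,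
      (induce_map_iso φ X).some.connected_iff.1 hconn, Finset.map_sdiff ..,
      (preconnected _).1 hpre⟩

theorem grundy_map (φ : G ↪g H) (W : Finset V) :
    grundy (OctalMove H) (W.map φ.toEmbedding) = grundy (OctalMove G) W := by
  refine (grundy_eq_of_bisimulation (R := fun U U' => U' = U.map φ.toEmbedding) ?_ ?_ rfl).symm
  · rintro U _ U' rfl h
    exact ⟨_, (octalMove_map_iff φ).2 h, rfl⟩
  · rintro U _ U'' rfl h
    obtain ⟨U', -, rfl⟩ := Finset.subset_map_iff.1 h.subset
    exact ⟨U', (octalMove_map_iff φ).1 h, rfl⟩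

end OctalMove

/-! ### The game on a rooted forest -/

/-- A forest on the vertex set `V` in which every vertex except the roots has a parent; `depth`
witnesses that the parent function has no infinite orbit. -/
structure RootedForest (V : Type*) where
  parent : V → Option V
  depth : V → ℕ
  depth_lt : ∀ {u p}, parent u = some p → depth p < depth u

namespace RootedForest

variable {V : Type*} (F : RootedForest V)

/-- The underlying undirected graph of a rooted forest. -/
def graph : SimpleGraph V := SimpleGraph.fromRel fun u p => F.parent u = some p

/-- The parent of `u`, if any, is outside `W`: when `u ∈ W`, it is a root of the forest induced on
`W`. -/
def IsOrphan (W : Finset V) (u : V) : Prop := ∀ p, F.parent u = some p → p ∉ W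

/-- The forest induced on `W` has at most one root, i.e. it is empty or a tree. -/
def RootUnique (W : Finset V) : Prop :=
  ∀ u ∈ W, ∀ v ∈ W, F.IsOrphan W u → F.IsOrphan W v → u = v

/-- `B` is the branch of `v` in the forest induced on `W`: it consists of `v` and of its
descendants. The equivalence characterizes `B` because the depth is bounded below. -/
def IsBranch (W : Finset V) (v : V) (B : Finset V) : Prop :=
  v ∈ W ∧ ∀ u, u ∈ B ↔ u ∈ W ∧ (u = v ∨ ∃ p ∈ B, F.parent u = some p)

variable {F} {W A B : Finset V} {u v : V}

theorem graph_adj : F.graph.Adj u v ↔ F.parent u = some v ∨ F.parent v = some u := by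
  rw [graph, SimpleGraph.fromRel_adj, and_iff_right_iff_imp]
  rintro h rfl
  exact lt_irrefl _ (F.depth_lt (or_self_iff.1 h))

theorem exists_isOrphan (hW : W.Nonempty) : ∃ r ∈ W, F.IsOrphan W r := by
  obtain ⟨r, hr, hmin⟩ := W.exists_min_image F.depth hW
  exact ⟨r, hr, fun p hp hpW => (hmin p hpW).not_gt (F.depth_lt hp)⟩

theorem exists_isOrphan_reachable (u : (W : Set V)) :
    ∃ r : (W : Set V), F.IsOrphan W r ∧ (F.graph.induce (W : Set V)).Reachable u r := by
  induction h : F.depth u using Nat.strong_induction_on generalizing u with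
  | _ n ih =>
    by_cases ho : F.IsOrphan W u
    · exact ⟨u, ho, .refl _⟩
    · simp only [IsOrphan, not_forall, not_not] at ho
      obtain ⟨p, hp, hpW⟩ := ho
      obtain ⟨r, hr, hpr⟩ := ih _ (h ▸ F.depth_lt hp) ⟨p, hpW⟩ rfl
      have hup : (F.graph.induce (W : Set V)).Adj u ⟨p, hpW⟩ := graph_adj.2 (.inl hp)
      exact ⟨r, hr, hup.reachable.trans hpr⟩

/-- A walk in `W` starting at an orphan can never leave its descendants. -/
theorem IsOrphan.ancestor_of_reachable {r x : (W : Set V)} (hr : F.IsOrphan W r)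
    (h : (F.graph.induce (W : Set V)).Reachable r x) :
    Relation.ReflTransGen (fun y p => F.parent y = some p ∧ p ∈ W) (x : V) r := by
  rw [SimpleGraph.reachable_iff_reflTransGen] at h
  induction h with
  | refl => exact .refl
  | @tail x y _ hxy ih =>
    rcases graph_adj.1 (SimpleGraph.induce_adj.1 hxy) with e | e
    · rcases ih.cases_head with e' | ⟨z, ⟨hz, -⟩, hzr⟩
      · exact absurd y.2 (hr _ (e' ▸ e))
      · rwa [Option.some_injective _ (e.symm.trans hz)]
    · exact .head ⟨e, x.2⟩ ih

theorem preconnected_iff_rootUnique :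
    (F.graph.induce (W : Set V)).Preconnected ↔ F.RootUnique W := by
  constructor
  · intro h u hu v hv hou hov
    rcases (IsOrphan.ancestor_of_reachable (r := ⟨u, hu⟩) hou (h _ ⟨v, hv⟩)).cases_head
      with e | ⟨p, ⟨hp, hpW⟩, -⟩
    · exact e.symm
    · exact absurd hpW (hov p hp)
  · intro h u v
    obtain ⟨r, hr, hur⟩ := exists_isOrphan_reachable u
    obtain ⟨r', hr', hvr⟩ := exists_isOrphan_reachable v
    obtain rfl : r = r' := Subtype.ext (h _ r.2 _ r'.2 hr hr')
    exact hur.trans hvr.symm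

theorem connected_iff_rootUnique :
    (F.graph.induce (W : Set V)).Connected ↔ F.RootUnique W ∧ W.Nonempty := by
  rw [SimpleGraph.connected_iff, preconnected_iff_rootUnique]
  exact and_congr_right' Finset.nonempty_coe_sort

theorem rootUnique_of_parent_mem (h : ∀ u ∈ W, u ≠ v → ∃ p ∈ W, F.parent u = some p) :
    F.RootUnique W := by
  have eq_v : ∀ u ∈ W, F.IsOrphan W u → u = v := fun u hu ho => by
    by_contra hne
    obtain ⟨p, hp, hup⟩ := h u hu hne
    exact ho p hup hp
  exact fun u hu u' hu' ho ho' => (eq_v u hu ho).trans (eq_v u' hu' ho').symm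

namespace IsBranch

theorem subset (h : F.IsBranch W v B) : B ⊆ W := fun u hu => ((h.2 u).1 hu).1

theorem rootUnique (h : F.IsBranch W v B) : F.RootUnique B :=
  rootUnique_of_parent_mem fun u hu hne => (((h.2 u).1 hu).2).resolve_left hne

theorem eq (h : F.IsBranch W v A) (h' : F.IsBranch W v B) : A = B := by
  ext u
  induction hd : F.depth u using Nat.strong_induction_on generalizing u with
  | _ d ih =>
    rw [h.2, h'.2]
    refine and_congr_right' (or_congr_right (exists_congr fun p => and_congr_left fun hp => ?_))
    exact ih _ (hd ▸ F.depth_lt hp) p rfl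

theorem of_rootUnique (hB : F.RootUnique B) (hv : v ∈ B) (ho : F.IsOrphan B v) (hBW : B ⊆ W)
    (hclosed : ∀ u ∈ W, ∀ p ∈ B, F.parent u = some p → u ∈ B) : F.IsBranch W v B := by
  refine ⟨hBW hv, fun u => ⟨fun hu => ⟨hBW hu, ?_⟩, ?_⟩⟩
  · refine or_iff_not_imp_left.2 fun hne => ?_
    by_contra! hu'
    exact hne (hB u hu v hv (fun p hp hpB => hu' p hpB hp) ho)
  · rintro ⟨hu, rfl | ⟨p, hp, hup⟩⟩
    exacts [hv, hclosed u hu p hp hup]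

variable [DecidableEq V]

theorem rootUnique_sdiff (hW : F.RootUnique W) (h : F.IsBranch W v B) :
    F.RootUnique (W \ B) := by
  have orphan : ∀ u ∈ W \ B, F.IsOrphan (W \ B) u → F.IsOrphan W u := by
    intro u hu ho p hp hpW
    rw [Finset.mem_sdiff] at hu
    by_cases hpB : p ∈ B
    · exact hu.2 ((h.2 u).2 ⟨hu.1, .inr ⟨p, hpB, hp⟩⟩)
    · exact ho p hp (Finset.mem_sdiff.2 ⟨hpW, hpB⟩)
  exact fun u hu u' hu' ho ho' => hW u (Finset.sdiff_subset hu) u' (Finset.sdiff_subset hu')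
    (orphan u hu ho) (orphan u' hu' ho')

end IsBranch

variable [DecidableEq V]

theorem exists_isBranch_sdiff {r : V} (hr : r ∈ A) (ho : F.IsOrphan W r) (hAW : A ⊆ W)
    (hA : F.RootUnique A) (hWA : F.RootUnique (W \ A)) (hne : (W \ A).Nonempty) :
    ∃ v, F.IsBranch W v (W \ A) := by
  obtain ⟨v, hv, hov⟩ := exists_isOrphan (F := F) hne
  refine ⟨v, .of_rootUnique hWA hv hov Finset.sdiff_subset fun u hu p hp hup => ?_⟩
  rw [Finset.mem_sdiff] at hp ⊢
  refine ⟨hu, fun huA => ?_⟩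
  have hou : F.IsOrphan A u := fun p' hp' =>
    Option.some_injective _ (hup.symm.trans hp') ▸ hp.2
  obtain rfl : u = r := hA u huA r hr hou fun p' hp' hp'A => ho p' hp' (hAW hp'A)
  exact ho p hup hp.1

theorem octalMove_graph_iff :
    OctalMove F.graph A W ↔ A ⊆ W ∧ ((W \ A).card = 1 ∨ (W \ A).card = 2) ∧
      F.RootUnique A ∧ F.RootUnique (W \ A) := by
  constructor
  · rintro ⟨X, hX, hcard, hconn, rfl, hpre⟩
    rw [Finset.sdiff_sdiff_eq_self hX]
    exact ⟨Finset.sdiff_subset, hcard, preconnected_iff_rootUnique.1 hpre,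
      (connected_iff_rootUnique.1 hconn).1⟩
  · rintro ⟨hA, hcard, hrA, hrWA⟩
    refine ⟨W \ A, Finset.sdiff_subset, hcard, connected_iff_rootUnique.2 ⟨hrWA, ?_⟩,
      (Finset.sdiff_sdiff_eq_self hA).symm, preconnected_iff_rootUnique.2 hrA⟩
    exact Finset.card_pos.1 (by omega)

theorem octalMove_graph_iff_isBranch (hW : F.RootUnique W) :
    OctalMove F.graph A W ↔ ∃ v B, F.IsBranch W v B ∧
      (A = B ∧ ((W \ B).card = 1 ∨ (W \ B).card = 2) ∨
        A = W \ B ∧ (B.card = 1 ∨ B.card = 2)) := by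
  rw [octalMove_graph_iff]
  constructor
  · rintro ⟨hAW, hcard, hA, hWA⟩
    have hne : (W \ A).Nonempty := Finset.card_pos.1 (by omega)
    have hAeq : W \ (W \ A) = A := Finset.sdiff_sdiff_eq_self hAW
    obtain ⟨r, hr, hor⟩ := exists_isOrphan (F := F) (hne.mono Finset.sdiff_subset)
    by_cases hrA : r ∈ A
    · obtain ⟨v, hv⟩ := exists_isBranch_sdiff hrA hor hAW hA hWA hne
      exact ⟨v, W \ A, hv, .inr ⟨hAeq.symm, hcard⟩⟩
    rcases A.eq_empty_or_nonempty with rfl | hAne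
    · rw [Finset.sdiff_empty] at hcard
      exact ⟨r, W, .of_rootUnique hW hr hor subset_rfl fun u hu _ _ _ => hu,
        .inr ⟨(Finset.sdiff_self W).symm, hcard⟩⟩
    · obtain ⟨v, hv⟩ := exists_isBranch_sdiff (Finset.mem_sdiff.2 ⟨hr, hrA⟩) hor
        Finset.sdiff_subset hWA (hAeq.symm ▸ hA) (hAeq.symm ▸ hAne)
      exact ⟨v, A, hAeq ▸ hv, .inl ⟨rfl, hcard⟩⟩
  · rintro ⟨v, B, hB, ⟨rfl, hcard⟩ | ⟨rfl, hcard⟩⟩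
    · exact ⟨hB.subset, hcard, hB.rootUnique, hB.rootUnique_sdiff hW⟩
    · rw [Finset.sdiff_sdiff_eq_self hB.subset]
      exact ⟨Finset.sdiff_subset, hcard, hB.rootUnique_sdiff hW, hB.rootUnique⟩

end RootedForest

/-! ### The ten classes in terms of residues -/

namespace StarClass

instance : DecidableEq StarClass := fun c c' => by
  cases c <;> cases c' <;> first | exact isTrue rfl | exact isFalse nofun

/-- The common Grundy value of the stars of a class. -/
def val : StarClass → ℕ
  | d0 | d0s => 0
  | d1 | d1s | d1b => 1
  | d2 | d2s | d2b => 2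
  | d3 | d3b => 3

/-- The Grundy value of a bistar whose two stars belong to the given classes. -/
def val₂ (c c' : StarClass) : ℕ := table c c' c.val c'.val

theorem val₂_comm (c c' : StarClass) : val₂ c c' = val₂ c' c := by
  cases c <;> cases c' <;> rfl

/-- A side `P₂` and the middle vertex form a path with 3 vertices, which preserves the value. -/
theorem val₂_d2s (c : StarClass) : val₂ d2s c = c.val := by
  cases c <;> rfl

theorem eq_of_val₂_eq {c c' : StarClass} (h : ∀ d, val₂ c d = val₂ c' d) : c = c' := by
  have hd0 := h d0
  have hd2s := h d2s
  clear h
  revert hd0 hd2s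
  cases c <;> cases c' <;> decide

/-- The class of a star with `a` paths of length 1 and `b` paths of length 2 modulo 3. -/
def ofCounts : ℕ → ℕ → StarClass
  | 0, 0 => d1s
  | 1, 0 => d2s
  | 0, 1 => d0s
  | 1, 1 => d1s
  | 0, 2 => d2s
  | 0, 3 => d1s
  | a, 0 => if a % 2 = 0 then d0s else d1b
  | a, 1 => if a % 2 = 0 then d2b else d3b
  | a, 2 => if a % 2 = 0 then d1b else d0s
  | a, 3 => if a % 2 = 0 then d3b else d2b
  | a, b => if b % 2 = 0 then (if a % 2 = 0 then d0 else d1) else (if a % 2 = 0 then d2 else d3)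

theorem ofCounts_add_two_left {a : ℕ} (ha : 2 ≤ a) (b : ℕ) :
    ofCounts (a + 2) b = ofCounts a b := by
  obtain ⟨a, rfl⟩ := Nat.exists_eq_add_of_le' ha
  rcases b with _ | _ | _ | _ | b <;> simp [ofCounts]

theorem ofCounts_add_two_right (a : ℕ) {b : ℕ} (hb : 4 ≤ b) :
    ofCounts a (b + 2) = ofCounts a b := by
  obtain ⟨b, rfl⟩ := Nat.exists_eq_add_of_le' hb
  rcases a with _ | _ | a <;> simp [ofCounts]

theorem forall_of_periodic {P : ℕ → ℕ → Prop} (ha : ∀ a b, 3 ≤ a → P a b → P (a + 2) b)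
    (hb : ∀ a b, 5 ≤ b → P a b → P a (b + 2)) (h : ∀ a < 5, ∀ b < 7, P a b) (a b : ℕ) :
    P a b := by
  induction a using Nat.strong_induction_on generalizing b with
  | _ a iha =>
    induction b using Nat.strong_induction_on with
    | _ b ihb =>
      rcases lt_or_ge a 5 with ha5 | ha5
      · rcases lt_or_ge b 7 with hb7 | hb7
        · exact h a ha5 b hb7
        · obtain ⟨b, rfl⟩ := Nat.exists_eq_add_of_le' (le_trans (by norm_num : 2 ≤ 7) hb7)
          exact hb a b (by omega) (ihb b (by omega))
      · obtain ⟨a, rfl⟩ := Nat.exists_eq_add_of_le' (le_trans (by norm_num : 2 ≤ 5) ha5)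
        exact ha a b (by omega) (iha a (by omega) b)

/-- The class of a star with `a` paths of length 1 and `b` paths of length 2 modulo 3, after adding
a path of length `r` modulo 3. -/
def joinPath (a b r : ℕ) : StarClass :=
  ofCounts (a + if r = 1 then 1 else 0) (b + if r = 2 then 1 else 0)

theorem joinPath_add_two_left {a : ℕ} (ha : 2 ≤ a) (b r : ℕ) :
    joinPath (a + 2) b r = joinPath a b r := by
  rw [joinPath, Nat.add_right_comm, ofCounts_add_two_left (Nat.le_add_right_of_le ha), joinPath]

theorem joinPath_add_two_right (a : ℕ) {b : ℕ} (hb : 4 ≤ b) (r : ℕ) :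
    joinPath a (b + 2) r = joinPath a b r := by
  rw [joinPath, Nat.add_right_comm, ofCounts_add_two_right _ (Nat.le_add_right_of_le hb), joinPath]

theorem val₂_joinPath_injective (a b : ℕ) (c : StarClass) :
    ∀ r < 3, ∀ r' < 3, val₂ (joinPath a b r) c = val₂ (joinPath a b r') c → r = r' := by
  revert a b
  refine forall_of_periodic ?_ ?_ ?_
  · intro a b ha
    simp only [joinPath_add_two_left (show 2 ≤ a by omega), imp_self]
  · intro a b hb
    simp only [joinPath_add_two_right a (show 4 ≤ b by omega), imp_self]
  · cases c <;> decide

/-- The classes reached by shortening a path whose length is not divisible by 3 by 1 or 2 vertices,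
without lowering the quotient of its length by 3. -/
def trims (a b : ℕ) : List StarClass :=
  (if 0 < a then [ofCounts (a - 1) b] else []) ++
    if 0 < b then [ofCounts a (b - 1), ofCounts (a + 1) (b - 1)] else []

theorem trims_add_two_left {a : ℕ} (ha : 3 ≤ a) (b : ℕ) : trims (a + 2) b = trims a b := by
  obtain ⟨a, rfl⟩ := Nat.exists_eq_add_of_le' ha
  simp [trims, show a + 3 + 2 - 1 = a + 2 + 2 by omega, show a + 3 + 2 + 1 = a + 3 + 1 + 2 by omega,
    ofCounts_add_two_left]

theorem trims_add_two_right (a : ℕ) {b : ℕ} (hb : 5 ≤ b) : trims a (b + 2) = trims a b := by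
  obtain ⟨b, rfl⟩ := Nat.exists_eq_add_of_le' hb
  simp [trims, show b + 5 + 2 - 1 = b + 4 + 2 by omega, ofCounts_add_two_right]

/-- The classes together with classes of options that suffice to determine the Grundy values. -/
def kinds : List (StarClass × List StarClass) :=
  [(d0, []), (d0s, [d1b]), (d0s, [d2s]), (d1, [d0]), (d1b, [d0s]), (d1s, [d0s, d2s]),
    (d2, [d0, d1]), (d2b, [d0s, d1b, d1s]), (d2b, [d0s, d1b, d3b]), (d2s, [d0s, d1s]),
    (d3, [d0, d1, d2]), (d3b, [d0s, d1b, d2b])]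

theorem exists_kind_subset_trims (a b : ℕ) :
    (b = 0 → 2 ≤ a) → ∃ k ∈ kinds, k.1 = ofCounts a b ∧ ∀ d ∈ k.2, d ∈ trims a b := by
  revert a b
  refine forall_of_periodic ?_ ?_ ?_
  · intro a b ha h _
    simpa only [ofCounts_add_two_left (show 2 ≤ a by omega), trims_add_two_left ha] using
      h fun _ => by omega
  · intro a b hb h _
    simpa only [ofCounts_add_two_right a (show 4 ≤ b by omega), trims_add_two_right a hb] using
      h fun _ => by omega
  · decide

theorem exists_val_eq_of_lt : ∀ k ∈ kinds, ∀ u < k.1.val, ∃ d ∈ k.2, d.val = u := by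
  decide

theorem exists_val₂_eq_of_lt : ∀ k ∈ kinds, ∀ k' ∈ kinds, ∀ u < val₂ k.1 k'.1,
    (∃ d ∈ k.2, val₂ d k'.1 = u) ∨ ∃ d ∈ k'.2, val₂ k.1 d = u := by
  decide

end StarClass

/-! ### The abstract game on paths, stars and bistars -/

/-- A subdivided star up to the order of its paths: `none` is the empty graph and `some m` the star
whose paths have the lengths in `m`. Lengths 0 are allowed and invisible, so that shortening a path
never changes the number of entries. -/
abbrev StarShape := Option (Multiset ℕ)

namespace StarShape

/-- The number of vertices. -/
def size : StarShape → ℕ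
  | none => 0
  | some m => 1 + m.sum

/-- The number of paths of length `r` modulo 3. -/
def residueCount (r : ℕ) (m : Multiset ℕ) : ℕ := m.countP (· % 3 = r)

/-- The class of a star shape, read off from its lengths modulo 3. -/
def cls : StarShape → StarClass
  | none => .d0s
  | some m => .ofCounts (residueCount 1 m) (residueCount 2 m)

/-- `Trim b a`: one obtains `b` from `a` by removing one or two vertices without cutting off the
centre, unless nothing remains. -/
inductive Trim : StarShape → StarShape → Prop
  | shorten {l j : ℕ} (m : Multiset ℕ) (hj : j < l) (hl : l ≤ j + 2) :
      Trim (some (j ::ₘ m)) (some (l ::ₘ m))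
  | remove {m : Multiset ℕ} (hm : m.sum ≤ 1) : Trim none (some m)

theorem residueCount_cons (r l : ℕ) (m : Multiset ℕ) :
    residueCount r (l ::ₘ m) = residueCount r m + if l % 3 = r then 1 else 0 :=
  Multiset.countP_cons ..

theorem cls_cons (l : ℕ) (m : Multiset ℕ) :
    cls (some (l ::ₘ m)) = .joinPath (residueCount 1 m) (residueCount 2 m) (l % 3) := by
  simp only [cls, residueCount_cons, StarClass.joinPath]

theorem residueCount_of_sum_le_one {m : Multiset ℕ} (hm : m.sum ≤ 1) :
    residueCount 1 m = m.sum ∧ residueCount 2 m = 0 := by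
  induction m using Multiset.induction with
  | empty => exact ⟨rfl, rfl⟩
  | cons l m ih =>
    rw [Multiset.sum_cons] at hm ⊢
    obtain ⟨h1, h2⟩ := ih (by omega)
    rw [residueCount_cons, residueCount_cons, h1, h2]
    obtain rfl | rfl : l = 0 ∨ l = 1 := by omega
    · simp
    · simp [add_comm]

theorem cls_of_sum_le_one {m : Multiset ℕ} (hm : m.sum ≤ 1) :
    cls (some m) = if m.sum = 0 then .d1s else .d2s := by
  rw [cls, (residueCount_of_sum_le_one hm).1, (residueCount_of_sum_le_one hm).2]
  obtain h | h : m.sum = 0 ∨ m.sum = 1 := by omega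
  all_goals rw [h]; rfl

theorem cls_of_size_le_one {a : StarShape} (ha : a.size ≤ 1) : a.cls = .d0s ∨ a.cls = .d1s := by
  rcases a with _ | m
  · exact .inl rfl
  · have hm : m.sum = 0 := by simpa [size] using ha
    exact .inr (by rw [cls_of_sum_le_one (by omega), if_pos hm])

/-- Such a star is a path with `l + 1 + m.sum` vertices. -/
theorem val_cls_cons {m : Multiset ℕ} (hm : m.sum ≤ 1) (l : ℕ) :
    (cls (some (l ::ₘ m))).val = (l + 1 + m.sum) % 3 := by
  rw [cls_cons, (residueCount_of_sum_le_one hm).1, (residueCount_of_sum_le_one hm).2,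
    Nat.add_assoc, Nat.add_mod]
  have h3 := Nat.mod_lt l three_pos
  generalize l % 3 = r at h3 ⊢
  generalize m.sum = n at hm ⊢
  interval_cases r <;> interval_cases n <;> rfl

theorem Trim.val₂_ne {a b : StarShape} (h : Trim b a) (c : StarClass) :
    b.cls.val₂ c ≠ a.cls.val₂ c := by
  cases h with
  | shorten m hj hl =>
    rw [cls_cons, cls_cons]
    intro e
    have := StarClass.val₂_joinPath_injective _ _ c _ (Nat.mod_lt _ three_pos) _
      (Nat.mod_lt _ three_pos) e
    omega
  | remove hm =>
    rw [cls_of_sum_le_one hm]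
    split_ifs <;> cases c <;> decide

theorem Trim.val_ne {a b : StarShape} (h : Trim b a) : b.cls.val ≠ a.cls.val := by
  simpa only [StarClass.val₂_comm, StarClass.val₂_d2s] using h.val₂_ne .d2s

theorem exists_trim_shorten {m : Multiset ℕ} {l j : ℕ} (hl : l ∈ m) (hj : j < l)
    (hlj : l ≤ j + 2) :
    ∃ b, Trim b (some m) ∧
      cls b = .joinPath (residueCount 1 (m.erase l)) (residueCount 2 (m.erase l)) (j % 3) := by
  refine ⟨some (j ::ₘ m.erase l), ?_, cls_cons _ _⟩
  nth_rw 2 [← Multiset.cons_erase hl]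
  exact .shorten _ hj hlj

theorem residueCount_eq_erase {m : Multiset ℕ} {l : ℕ} (hl : l ∈ m) (r : ℕ) :
    residueCount r m = residueCount r (m.erase l) + if l % 3 = r then 1 else 0 := by
  rw [← residueCount_cons, Multiset.cons_erase hl]

theorem exists_trim_of_mem_trims {m : Multiset ℕ} {d : StarClass}
    (hd : d ∈ StarClass.trims (residueCount 1 m) (residueCount 2 m)) :
    ∃ b, Trim b (some m) ∧ cls b = d := by
  have exists_path {r : ℕ} (hr : 0 < residueCount r m) : ∃ l ∈ m, l % 3 = r :=
    Multiset.countP_pos.1 hr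
  simp only [StarClass.trims, List.mem_append, List.mem_ite_nil_right, List.mem_cons,
    List.not_mem_nil, or_false] at hd
  rcases hd with ⟨h, rfl⟩ | ⟨h, rfl | rfl⟩
  all_goals
    obtain ⟨l, hl, hr⟩ := exists_path h
    rw [residueCount_eq_erase hl 1, residueCount_eq_erase hl 2, hr]
  · obtain ⟨b, hb, e⟩ := exists_trim_shorten hl (j := l - 1) (by omega) (by omega)
    exact ⟨b, hb, by rw [e, show (l - 1) % 3 = 0 by omega]; rfl⟩
  · obtain ⟨b, hb, e⟩ := exists_trim_shorten hl (j := l - 2) (by omega) (by omega)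
    exact ⟨b, hb, by rw [e, show (l - 2) % 3 = 0 by omega]; rfl⟩
  · obtain ⟨b, hb, e⟩ := exists_trim_shorten hl (j := l - 1) (by omega) (by omega)
    exact ⟨b, hb, by rw [e, show (l - 1) % 3 = 1 by omega]; rfl⟩

theorem exists_trim_of_long_path {m : Multiset ℕ} {l r : ℕ} (hl : l ∈ m) (h3 : 3 ≤ l) (hr : r < 3)
    (hne : r ≠ l % 3) :
    ∃ b, Trim b (some m) ∧
      cls b = .joinPath (residueCount 1 (m.erase l)) (residueCount 2 (m.erase l)) r := by
  obtain h | h : (l - 1) % 3 = r ∨ (l - 2) % 3 = r := by omega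
  all_goals
    rw [← h]
    exact exists_trim_shorten hl (by omega) (by omega)

theorem sum_eq_residueCount {m : Multiset ℕ} (hm : ∀ l ∈ m, l < 3) (h2 : residueCount 2 m = 0) :
    m.sum = residueCount 1 m := by
  induction m using Multiset.induction with
  | empty => rfl
  | cons l m ih =>
    rw [Multiset.forall_mem_cons] at hm
    rw [residueCount_cons, Nat.add_eq_zero_iff, ite_eq_right_iff] at h2
    rw [Multiset.sum_cons, residueCount_cons, ih hm.2 h2.1]
    split_ifs <;> omega

theorem exists_kind_of_few_residues {m : Multiset ℕ} (h1 : residueCount 1 m < 2)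
    (h2 : residueCount 2 m = 0) (hsum : 1 < m.sum) :
    ∃ k ∈ StarClass.kinds, k.1 = cls (some m) ∧
      ∀ d ∈ k.2, ∃ b, Trim b (some m) ∧ cls b = d := by
  obtain ⟨l, hl, h3⟩ : ∃ l ∈ m, 3 ≤ l := by
    by_contra! h
    exact (hsum.trans_eq (sum_eq_residueCount h h2)).not_ge (by omega)
  have other_residue := fun r => exists_trim_of_long_path (r := r) hl h3
  have e1 := residueCount_eq_erase hl 1
  have e2 : residueCount 2 (m.erase l) = 0 := by have := residueCount_eq_erase hl 2; omega
  rw [e2] at other_residue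
  rw [cls, h2]
  obtain hr | hr : l % 3 = 0 ∨ l % 3 = 1 := by
    have := residueCount_eq_erase hl 2
    split_ifs at this <;> omega
  · simp only [hr, zero_ne_one, if_false, add_zero] at e1
    rw [← e1] at other_residue
    obtain h | h : residueCount 1 m = 0 ∨ residueCount 1 m = 1 := by omega
    all_goals rw [h] at other_residue ⊢
    · exact ⟨(.d1s, [.d0s, .d2s]), by decide, rfl, List.forall_mem_cons.2
        ⟨other_residue 2 (by omega) (by omega),
          List.forall_mem_singleton.2 (other_residue 1 (by omega) (by omega))⟩⟩
    · exact ⟨(.d2s, [.d0s, .d1s]), by decide, rfl, List.forall_mem_cons.2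
        ⟨other_residue 1 (by omega) (by omega),
          List.forall_mem_singleton.2 (other_residue 2 (by omega) (by omega))⟩⟩
  · simp only [hr, if_true] at e1
    rw [show residueCount 1 (m.erase l) = 0 by omega] at other_residue
    rw [show residueCount 1 m = 1 by omega]
    exact ⟨(.d2s, [.d0s, .d1s]), by decide, rfl, List.forall_mem_cons.2
      ⟨other_residue 2 (by omega) (by omega),
        List.forall_mem_singleton.2 (other_residue 0 (by omega) (by omega))⟩⟩

/-- The classes of the trims of a star determine the Grundy values, except for the three smallest
stars, where removing a star together with its neighbour also has to be taken into account: in a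
bistar, it leads to the same value as replacing the class of the star with `d2s`. -/
theorem exists_kind (a : StarShape) :
    ∃ k ∈ StarClass.kinds, k.1 = a.cls ∧
      ∀ d ∈ k.2, (∃ b, Trim b a ∧ b.cls = d) ∨ d = .d2s ∧ a.size ≤ 1 := by
  rcases a with _ | m
  · exact ⟨(.d0s, [.d2s]), by decide, rfl, by simp [size]⟩
  by_cases h : residueCount 2 m = 0 → 2 ≤ residueCount 1 m
  · obtain ⟨k, hk, e, ht⟩ := StarClass.exists_kind_subset_trims _ _ h
    exact ⟨k, hk, e, fun d hd => .inl (exists_trim_of_mem_trims (ht d hd))⟩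
  obtain ⟨h2, h1⟩ := Classical.not_imp.1 h
  rcases lt_or_ge 1 m.sum with hsum | hsum
  · obtain ⟨k, hk, e, ht⟩ := exists_kind_of_few_residues (not_le.1 h1) h2 hsum
    exact ⟨k, hk, e, fun d hd => .inl (ht d hd)⟩
  · rw [cls_of_sum_le_one hsum]
    obtain h0 | h1 : m.sum = 0 ∨ m.sum = 1 := by omega
    · refine ⟨(.d1s, [.d0s, .d2s]), by decide, by rw [h0]; rfl, ?_⟩
      exact List.forall_mem_cons.2 ⟨.inl ⟨none, .remove hsum, rfl⟩,
        List.forall_mem_singleton.2 (.inr ⟨rfl, by simp [size, h0]⟩)⟩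
    · refine ⟨(.d2s, [.d0s, .d1s]), by decide, by rw [h1]; rfl, ?_⟩
      refine List.forall_mem_cons.2 ⟨.inl ⟨none, .remove hsum, rfl⟩,
        List.forall_mem_singleton.2 (.inl (exists_trim_of_mem_trims ?_))⟩
      rw [(residueCount_of_sum_le_one hsum).1, h1, h2]
      decide

end StarShape

/-- The connected graphs that occur in the game on a bistar, up to isomorphism: paths, stars (the
empty one included), and bistars, given by their two sides. -/
inductive Shape
  | path (n : ℕ)
  | star (a : StarShape)
  | bistar (p : Bool → StarShape)

namespace Shape

open StarShape (Trim cls)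

/-- The number of vertices. -/
def size : Shape → ℕ
  | path n => n
  | star a => a.size
  | bistar p => 1 + (p false).size + (p true).size

theorem size_bistar (p : Bool → StarShape) (s : Bool) :
    size (bistar p) = 1 + (p s).size + (p !s).size := by
  cases s
  · rfl
  · exact Nat.add_right_comm ..

theorem size_bistar_update (p : Bool → StarShape) (s : Bool) (b : StarShape) :
    size (bistar (Function.update p s b)) = 1 + b.size + (p !s).size := by
  rw [size_bistar _ s, Function.update_self, Function.update_of_ne (Bool.not_ne_self s)]

/-- `Cut P A B`: the tree `P`, rooted at the middle vertex of a bistar, the centre of a star or an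
end of a path, is the disjoint union of a branch `A` and of the remaining tree `B`. -/
inductive Cut : Shape → Shape → Shape → Prop
  | whole (P : Shape) : Cut P P (star none)
  | path {n j : ℕ} (hj : j < n) : Cut (path n) (path (n - j)) (path j)
  | starLeg {l j : ℕ} (m : Multiset ℕ) (hj : j < l) :
      Cut (star (some (l ::ₘ m))) (path (l - j)) (star (some (j ::ₘ m)))
  | center {p : Bool → StarShape} {s : Bool} {m : Multiset ℕ} (hs : p s = some m) :
      Cut (bistar p) (star (p s)) (bistar (Function.update p s none))
  | bistarLeg {p : Bool → StarShape} {s : Bool} {l j : ℕ} {m : Multiset ℕ}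
      (hs : p s = some (l ::ₘ m)) (hj : j < l) :
      Cut (bistar p) (path (l - j)) (bistar (Function.update p s (some (j ::ₘ m))))

theorem Cut.size_add_size {P A B : Shape} (h : Cut P A B) : A.size + B.size = P.size := by
  cases h with
  | whole => rfl
  | path hj => exact Nat.sub_add_cancel hj.le
  | starLeg m hj =>
    simp only [size, StarShape.size, Multiset.sum_cons]
    omega
  | @center p s m hs =>
    rw [size_bistar p s, size_bistar_update]
    simp only [size, StarShape.size]
    omega
  | @bistarLeg p s l j m hs hj =>
    rw [size_bistar p s, size_bistar_update, hs]
    simp only [size, StarShape.size, Multiset.sum_cons]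
    omega

/-- `Move Q P`: one passes from `P` to `Q` by cutting `P` into two parts and removing the one that
is not `Q`, which has one or two vertices. -/
def Move (Q P : Shape) : Prop :=
  ∃ A B, Cut P A B ∧ (Q = A ∧ (B.size = 1 ∨ B.size = 2) ∨ Q = B ∧ (A.size = 1 ∨ A.size = 2))

instance : IsWellFounded Shape Move where
  wf := by
    refine Subrelation.wf (r := InvImage (· < ·) size) ?_ (InvImage.wf _ Nat.lt_wfRel.wf)
    rintro Q P ⟨A, B, hcut, h⟩
    have := hcut.size_add_size
    change Q.size < P.size
    rcases h with ⟨rfl, h⟩ | ⟨rfl, h⟩ <;> omega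

/-- The Grundy value of a shape. -/
def value : Shape → ℕ
  | path n => n % 3
  | star a => a.cls.val
  | bistar p => (p false).cls.val₂ (p true).cls

theorem value_bistar (p : Bool → StarShape) (s : Bool) :
    value (bistar p) = (p s).cls.val₂ (p !s).cls := by
  cases s
  · rfl
  · exact StarClass.val₂_comm ..

theorem value_bistar_update (p : Bool → StarShape) (s : Bool) (b : StarShape) :
    value (bistar (Function.update p s b)) = b.cls.val₂ (p !s).cls := by
  rw [value_bistar _ s, Function.update_self, Function.update_of_ne (Bool.not_ne_self s)]

theorem move_star_of_trim {a b : StarShape} (h : Trim b a) : Move (star b) (star a) := by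
  cases h with
  | shorten m hj hl => exact ⟨_, _, .starLeg m hj, .inr ⟨rfl, by simp only [size]; omega⟩⟩
  | remove hm =>
    exact ⟨_, _, .whole _, .inr ⟨rfl, by simp only [size, StarShape.size]; omega⟩⟩

theorem move_bistar_of_trim {p : Bool → StarShape} {s : Bool} {b : StarShape}
    (h : Trim b (p s)) : Move (bistar (Function.update p s b)) (bistar p) := by
  generalize hs : p s = a at h
  cases h with
  | shorten m hj hl => exact ⟨_, _, .bistarLeg hs hj, .inr ⟨rfl, by simp only [size]; omega⟩⟩
  | remove hm =>
    exact ⟨_, _, .center hs, .inr ⟨rfl, by simp only [hs, size, StarShape.size]; omega⟩⟩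

theorem move_bistar_star {p : Bool → StarShape} {s : Bool} (h : (p !s).size ≤ 1) :
    Move (star (p s)) (bistar p) := by
  cases hs : p s with
  | none =>
    refine ⟨_, _, .whole _, .inr ⟨rfl, ?_⟩⟩
    rw [size_bistar p s, hs, StarShape.size]
    omega
  | some m =>
    refine ⟨_, _, .center hs, .inl ⟨by rw [hs], ?_⟩⟩
    rw [size_bistar_update, StarShape.size]
    omega

theorem cases_of_move_path {Q : Shape} {n : ℕ} (h : Move Q (path n)) :
    (∃ j < n, n ≤ j + 2 ∧ Q = path j) ∨ Q = star none ∧ 1 ≤ n ∧ n ≤ 2 := by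
  obtain ⟨A, B, hcut, h⟩ := h
  cases hcut with
  | whole =>
    rcases h with ⟨-, h⟩ | ⟨rfl, h⟩ <;> simp only [size, StarShape.size] at h
    · omega
    · exact .inr ⟨rfl, by omega⟩
  | @path _ j hj =>
    rcases h with ⟨rfl, h⟩ | ⟨rfl, h⟩ <;> simp only [size] at h
    · exact .inl ⟨n - j, by omega, by omega, rfl⟩
    · exact .inl ⟨j, hj, by omega, rfl⟩

theorem cases_of_move_star {Q : Shape} {a : StarShape} (h : Move Q (star a)) :
    (∃ b, Trim b a ∧ Q = star b) ∨
      ∃ l j m, a = some (l ::ₘ m) ∧ j < l ∧ m.sum + j ≤ 1 ∧ Q = path (l - j) := by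
  obtain ⟨A, B, hcut, h⟩ := h
  cases hcut with
  | whole =>
    rcases h with ⟨-, h⟩ | ⟨rfl, h⟩
    · simp [size, StarShape.size] at h
    · rcases a with _ | m <;> simp only [size, StarShape.size] at h
      · omega
      · exact .inl ⟨none, .remove (by omega), rfl⟩
  | @starLeg l j m hj =>
    rcases h with ⟨rfl, h⟩ | ⟨rfl, h⟩ <;>
      simp only [size, StarShape.size, Multiset.sum_cons] at h
    · exact .inr ⟨l, j, m, rfl, hj, by omega, rfl⟩
    · exact .inl ⟨_, .shorten m hj (by omega), rfl⟩

theorem cases_of_move_bistar {Q : Shape} {p : Bool → StarShape} (h : Move Q (bistar p)) :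
    (∃ s b, Trim b (p s) ∧ Q = bistar (Function.update p s b)) ∨
      (∃ s, (p !s).size ≤ 1 ∧ Q = star (p s)) ∨
        ∃ s l m, p s = some (l ::ₘ m) ∧ m.sum = 0 ∧ p (!s) = none ∧ Q = path l := by
  have eq_none {a : StarShape} (ha : a.size = 0) : a = none := by
    rcases a with _ | m
    · rfl
    · simp [StarShape.size] at ha
  obtain ⟨A, B, hcut, h⟩ := h
  cases hcut with
  | whole =>
    rcases h with ⟨-, h⟩ | ⟨rfl, h⟩
    · simp [size, StarShape.size] at h
    · obtain ⟨s, hs⟩ : ∃ s, (p s).size = 0 := by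
        simp only [size] at h
        rcases Nat.eq_zero_or_pos (p false).size with h0 | h0
        exacts [⟨false, h0⟩, ⟨true, by omega⟩]
      rw [size_bistar p s] at h
      exact .inr (.inl ⟨s, by omega, by rw [eq_none hs]⟩)
  | @center _ s m hs =>
    rcases h with ⟨rfl, h⟩ | ⟨rfl, h⟩
    · rw [size_bistar_update, StarShape.size] at h
      exact .inr (.inl ⟨s, by omega, rfl⟩)
    · simp only [hs, size, StarShape.size] at h
      exact .inl ⟨s, none, hs ▸ .remove (by omega), rfl⟩
  | @bistarLeg _ s l j m hs hj =>
    rcases h with ⟨rfl, h⟩ | ⟨rfl, h⟩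
    · rw [size_bistar_update, StarShape.size, Multiset.sum_cons] at h
      obtain rfl : j = 0 := by omega
      exact .inr (.inr ⟨s, l, m, hs, by omega, eq_none (by omega), rfl⟩)
    · simp only [size] at h
      exact .inl ⟨s, _, hs ▸ .shorten m hj (by omega), rfl⟩

theorem value_ne_of_move_path {Q : Shape} {n : ℕ} (h : Move Q (path n)) :
    Q.value ≠ (path n).value := by
  rcases cases_of_move_path h with ⟨j, hj, hn, rfl⟩ | ⟨rfl, h1, h2⟩
  · simp only [value]
    omega
  · change 0 ≠ n % 3
    omega

theorem value_ne_of_move_star {Q : Shape} {a : StarShape} (h : Move Q (star a)) :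
    Q.value ≠ (star a).value := by
  rcases cases_of_move_star h with ⟨b, hb, rfl⟩ | ⟨l, j, m, rfl, hj, hm, rfl⟩
  · exact hb.val_ne
  rw [value, value, StarShape.val_cls_cons (Nat.le_of_add_right_le hm)]
  omega

theorem value_ne_of_move_bistar {Q : Shape} {p : Bool → StarShape} (h : Move Q (bistar p)) :
    Q.value ≠ (bistar p).value := by
  rcases cases_of_move_bistar h with ⟨s, b, hb, rfl⟩ | ⟨s, hs, rfl⟩ | ⟨s, l, m, hs, hm, hn, rfl⟩
  · rw [value_bistar_update, value_bistar p s]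
    exact hb.val₂_ne _
  · rw [value_bistar p s, value]
    rcases StarShape.cls_of_size_le_one hs with e | e <;> rw [e] <;>
      generalize (p s).cls = c <;> cases c <;> decide
  · obtain ⟨h1, h2⟩ := StarShape.residueCount_of_sum_le_one (hm.trans_le zero_le_one)
    rw [value_bistar p s, hs, hn, value, StarShape.cls_cons, h1, h2, hm]
    obtain hr | hr | hr : l % 3 = 0 ∨ l % 3 = 1 ∨ l % 3 = 2 := by omega
    all_goals rw [hr]; decide

theorem exists_move_path {n u : ℕ} (hu : u < (path n).value) :
    ∃ Q, Move Q (path n) ∧ Q.value = u := by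
  simp only [value] at hu
  refine ⟨path (n - (n % 3 - u)), ⟨_, _, .path (by omega), .inr ⟨rfl, ?_⟩⟩, ?_⟩
  all_goals simp only [size, value]; omega

theorem exists_move_star {a : StarShape} {u : ℕ} (hu : u < (star a).value) :
    ∃ Q, Move Q (star a) ∧ Q.value = u := by
  obtain ⟨k, hk, e, ht⟩ := a.exists_kind
  obtain ⟨d, hd, rfl⟩ := StarClass.exists_val_eq_of_lt k hk u (e ▸ hu)
  rcases ht d hd with ⟨b, hb, rfl⟩ | ⟨rfl, ha⟩
  · exact ⟨_, move_star_of_trim hb, rfl⟩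
  · simp only [value] at hu
    rcases StarShape.cls_of_size_le_one ha with e | e <;> exact absurd (e ▸ hu) (by decide)

theorem exists_move_bistar_of_kind {p : Bool → StarShape} {s : Bool} {d : StarClass}
    (h : (∃ b, Trim b (p s) ∧ b.cls = d) ∨ d = .d2s ∧ (p s).size ≤ 1) :
    ∃ Q, Move Q (bistar p) ∧ Q.value = d.val₂ (p !s).cls := by
  rcases h with ⟨b, hb, rfl⟩ | ⟨rfl, hs⟩
  · exact ⟨_, move_bistar_of_trim hb, value_bistar_update p s b⟩
  · exact ⟨_, move_bistar_star (s := !s) (by rwa [Bool.not_not]), (StarClass.val₂_d2s _).symm⟩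

theorem exists_move_bistar {p : Bool → StarShape} {u : ℕ} (hu : u < (bistar p).value) :
    ∃ Q, Move Q (bistar p) ∧ Q.value = u := by
  obtain ⟨k, hk, e, ht⟩ := (p false).exists_kind
  obtain ⟨k', hk', e', ht'⟩ := (p true).exists_kind
  rw [value, ← e, ← e'] at hu
  rcases StarClass.exists_val₂_eq_of_lt k hk k' hk' u hu with ⟨d, hd, rfl⟩ | ⟨d, hd, rfl⟩
  · rw [e']
    exact exists_move_bistar_of_kind (s := false) (ht d hd)
  · rw [e, StarClass.val₂_comm]
    exact exists_move_bistar_of_kind (s := true) (ht' d hd)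

theorem grundy_eq_value (P : Shape) : grundy Move P = P.value := by
  refine grundy_eq_of_forall ?_ ?_ P
  · rintro (_ | _ | _) Q h
    exacts [value_ne_of_move_path h, value_ne_of_move_star h, value_ne_of_move_bistar h]
  · rintro (_ | _ | _) u hu
    exacts [exists_move_path hu, exists_move_star hu, exists_move_bistar hu]

end Shape

/-! ### The universal bistar -/

/-- The lengths of the paths of a subdivided star, in order; `none` stands for the empty graph. -/
abbrev StarLengths := Option (List ℕ)

namespace StarLengths

/-- The length of the path number `i`, and 0 if there is no such path. -/
def legLength : StarLengths → ℕ → ℕ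
  | none, _ => 0
  | some L, i => L.getD i 0

/-- Changes the length of the path number `i` to `n`, if there is such a path. -/
def setLeg (x : StarLengths) (i n : ℕ) : StarLengths := x.map (List.set · i n)

/-- Forgets the order of the paths. -/
def shape (x : StarLengths) : StarShape := x.map (↑)

theorem exists_getElem_of_lt_legLength {x : StarLengths} {i j : ℕ} (h : j < x.legLength i) :
    ∃ (L : List ℕ) (hi : i < L.length), x = some L ∧ x.legLength i = L[i] := by
  rcases x with _ | L
  · exact absurd h (Nat.not_lt_zero j)
  · have hi : i < L.length := by
      by_contra hi
      rw [legLength, List.getD_eq_default _ _ (not_lt.1 hi)] at h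
      exact Nat.not_lt_zero j h
    exact ⟨L, hi, rfl, List.getD_eq_getElem _ _ hi⟩

theorem isSome_of_lt_legLength {x : StarLengths} {i j : ℕ} (h : j < x.legLength i) : x.isSome := by
  obtain ⟨L, -, rfl, -⟩ := exists_getElem_of_lt_legLength h
  rfl

theorem legLength_setLeg {x : StarLengths} {i j : ℕ} (h : j < x.legLength i) (n k : ℕ) :
    (x.setLeg i n).legLength k = if k = i then n else x.legLength k := by
  obtain ⟨L, hi, rfl, -⟩ := exists_getElem_of_lt_legLength h
  simp only [setLeg, legLength, Option.map_some, List.getD_eq_getElem?_getD, List.getElem?_set]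
  grind

theorem isSome_setLeg (x : StarLengths) (i n : ℕ) : (x.setLeg i n).isSome = x.isSome :=
  Option.isSome_map

theorem exists_shape_setLeg {x : StarLengths} {i j : ℕ} (h : j < x.legLength i) :
    ∃ m, x.shape = some (x.legLength i ::ₘ m) ∧ ∀ n, (x.setLeg i n).shape = some (n ::ₘ m) := by
  obtain ⟨L, hi, rfl, e⟩ := exists_getElem_of_lt_legLength h
  rw [e]
  refine ⟨↑(L.eraseIdx i), congrArg some ?_, fun n => congrArg some ?_⟩ <;>
    rw [Multiset.cons_coe, Multiset.coe_eq_coe]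
  · exact (List.getElem_cons_eraseIdx_perm hi).symm
  · exact List.set_perm_cons_eraseIdx hi n

theorem exists_legLength_eq {x : StarLengths} {l : ℕ} {m : Multiset ℕ} (hl : 0 < l)
    (h : x.shape = some (l ::ₘ m)) :
    ∃ i, x.legLength i = l ∧ ∀ n, (x.setLeg i n).shape = some (n ::ₘ m) := by
  obtain ⟨L, rfl, hL⟩ := Option.map_eq_some_iff.1 h
  have hmem : l ∈ L := by rw [← Multiset.mem_coe, hL]; exact Multiset.mem_cons_self l m
  obtain ⟨i, hi, e⟩ := List.getElem_of_mem hmem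
  have hleg : legLength (some L) i = l := (List.getD_eq_getElem _ _ hi).trans e
  obtain ⟨m', hm', hset⟩ := exists_shape_setLeg (hl.trans_eq hleg.symm)
  rw [h, hleg, Option.some_inj, Multiset.cons_inj_right] at hm'
  exact ⟨i, hleg, hm' ▸ hset⟩

end StarLengths

/-- The vertices of an infinite bistar that contains all others: the middle vertex, the centre on
each of the two sides, and the vertex number `j`, from the centre, of the path number `i` on each
side. -/
inductive BistarVertex : Type
  | mid
  | cen (s : Bool)
  | leg (s : Bool) (i j : ℕ)
  deriving DecidableEq

namespace BistarVertex

open StarLengths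

/-- The tree on `BistarVertex` rooted at the middle vertex. -/
def tree : RootedForest BistarVertex where
  parent
    | mid => none
    | cen _ => some mid
    | leg s _ 0 => some (cen s)
    | leg s i (j + 1) => some (leg s i j)
  depth
    | mid => 0
    | cen _ => 1
    | leg _ _ j => j + 2
  depth_lt {u p} h := by
    rcases u with _ | s | ⟨s, i, _ | j⟩ <;> cases h <;> simp

theorem parent_eq_leg {u : BistarVertex} {s : Bool} {i j : ℕ} :
    tree.parent u = some (leg s i j) ↔ u = leg s i (j + 1) := by
  rcases u with _ | s | ⟨s, i, _ | j⟩ <;> simp [tree]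

/-- The vertices `lo ≤ j < hi` of a path. -/
def segment (s : Bool) (i lo hi : ℕ) : Finset BistarVertex := (Finset.Ico lo hi).image (leg s i)

/-- The subdivided star on side `s` with given lengths of paths. -/
def starSet (s : Bool) : StarLengths → Finset BistarVertex
  | none => ∅
  | some L =>
    insert (cen s) ((Finset.range L.length).biUnion fun i => segment s i 0 (L.getD i 0))

/-- The bistar whose sides have given lengths of paths. -/
def bistarSet (p : Bool → StarLengths) : Finset BistarVertex :=
  insert mid (Finset.univ.biUnion fun s => starSet s (p s))

variable {s t : Bool} {i j k lo hi : ℕ} {x : StarLengths} {p : Bool → StarLengths}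

theorem mem_segment {v : BistarVertex} :
    v ∈ segment s i lo hi ↔ ∃ j, lo ≤ j ∧ j < hi ∧ v = leg s i j := by
  simp [segment, and_assoc, eq_comm]

theorem leg_mem_segment : leg t k j ∈ segment s i lo hi ↔ t = s ∧ k = i ∧ lo ≤ j ∧ j < hi := by
  rw [mem_segment]
  grind

theorem mid_notMem_starSet : mid ∉ starSet s x := by
  rcases x with _ | L <;> simp [starSet, mem_segment]

theorem cen_mem_starSet : cen t ∈ starSet s x ↔ t = s ∧ x.isSome := by
  rcases x with _ | L <;> simp [starSet, mem_segment]

theorem leg_mem_starSet : leg t i j ∈ starSet s x ↔ t = s ∧ j < x.legLength i := by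
  rcases x with _ | L
  · simp [starSet, legLength]
  · simp only [starSet, legLength, Finset.mem_insert, reduceCtorEq, false_or, Finset.mem_biUnion,
      Finset.mem_range, leg_mem_segment, Nat.zero_le, true_and]
    grind

theorem mid_mem_bistarSet : mid ∈ bistarSet p := Finset.mem_insert_self ..

theorem cen_mem_bistarSet : cen s ∈ bistarSet p ↔ (p s).isSome := by
  simp only [bistarSet, Finset.mem_insert, reduceCtorEq, false_or, Finset.mem_biUnion,
    Finset.mem_univ, true_and, cen_mem_starSet, exists_eq_left']

theorem leg_mem_bistarSet : leg s i j ∈ bistarSet p ↔ j < (p s).legLength i := by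
  simp only [bistarSet, Finset.mem_insert, reduceCtorEq, false_or, Finset.mem_biUnion,
    Finset.mem_univ, true_and, leg_mem_starSet, exists_eq_left']

theorem card_segment : (segment s i lo hi).card = hi - lo := by
  rw [segment, Finset.card_image_of_injective _ fun _ _ h => (leg.inj h).2.2, Nat.card_Ico]

theorem card_starSet : (starSet s x).card = x.shape.size := by
  rcases x with _ | L
  · rfl
  rw [starSet, Finset.card_insert_of_notMem (by simp [mem_segment]), Finset.card_biUnion]
  · simp [card_segment, shape, StarShape.size, Finset.sum_range, add_comm]
  · intro i _ k _ hik
    refine Finset.disjoint_left.2 fun v hv hv' => ?_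
    obtain ⟨j, -, -, rfl⟩ := mem_segment.1 hv
    exact hik (leg_mem_segment.1 hv').2.1

theorem card_bistarSet : (bistarSet p).card = (Shape.bistar fun s => (p s).shape).size := by
  have hmid : mid ∉ starSet false (p false) ∪ starSet true (p true) := by
    simp [mid_notMem_starSet]
  have hdisj : Disjoint (starSet false (p false)) (starSet true (p true)) := by
    rw [Finset.disjoint_left]
    rintro (_ | t | ⟨t, i, j⟩) hv hv'
    · exact mid_notMem_starSet hv
    · exact Bool.false_ne_true ((cen_mem_starSet.1 hv).1.symm.trans (cen_mem_starSet.1 hv').1)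
    · exact Bool.false_ne_true ((leg_mem_starSet.1 hv).1.symm.trans (leg_mem_starSet.1 hv').1)
  have hunion : (Finset.univ.biUnion fun s => starSet s (p s)) =
      starSet false (p false) ∪ starSet true (p true) := by
    ext v
    simp [or_comm]
  rw [bistarSet, hunion, Finset.card_insert_of_notMem hmid, Finset.card_union_of_disjoint hdisj,
    card_starSet, card_starSet, Shape.size]
  omega

/-! ### Cutting the bistar -/

theorem isBranch_leg {W : Finset BistarVertex} {n : ℕ} (hj : j < n)
    (hW : ∀ k, j ≤ k → (leg s i k ∈ W ↔ k < n)) :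
    tree.IsBranch W (leg s i j) (segment s i j n) := by
  refine ⟨(hW j le_rfl).2 hj, fun u => ?_⟩
  constructor
  · intro hu
    obtain ⟨k, hjk, hkn, rfl⟩ := mem_segment.1 hu
    refine ⟨(hW k hjk).2 hkn, ?_⟩
    rcases hjk.eq_or_lt with rfl | hjk
    · exact .inl rfl
    obtain ⟨k, rfl⟩ := Nat.exists_eq_add_one_of_ne_zero (Nat.ne_zero_of_lt hjk)
    exact .inr ⟨leg s i k, by rw [leg_mem_segment]; grind, rfl⟩
  · rintro ⟨hu, rfl | ⟨p, hp, hup⟩⟩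
    · exact leg_mem_segment.2 ⟨rfl, rfl, le_rfl, hj⟩
    · obtain ⟨k, hjk, -, rfl⟩ := mem_segment.1 hp
      rw [parent_eq_leg] at hup
      subst hup
      exact leg_mem_segment.2 ⟨rfl, rfl, by omega, (hW _ (by omega)).1 hu⟩

theorem isBranch_cen {W : Finset BistarVertex} (hcen : cen s ∈ W) (hx : x.isSome)
    (hW : ∀ i k, leg s i k ∈ W ↔ k < x.legLength i) :
    tree.IsBranch W (cen s) (starSet s x) := by
  refine ⟨hcen, fun u => ?_⟩
  rcases u with _ | t | ⟨t, i, _ | j⟩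
  · simp [mid_notMem_starSet, tree]
  · simp only [cen_mem_starSet, hx, and_true, cen.injEq, tree, Option.some_inj, exists_eq_right',
      mid_notMem_starSet, or_false]
    grind
  · simp only [leg_mem_starSet, reduceCtorEq, tree, Option.some_inj, exists_eq_right',
      cen_mem_starSet, hx, and_true, false_or]
    grind
  · simp only [leg_mem_starSet, reduceCtorEq, tree, Option.some_inj, exists_eq_right', false_or]
    grind

theorem isBranch_mid : tree.IsBranch (bistarSet p) mid (bistarSet p) := by
  refine ⟨mid_mem_bistarSet, fun u => ?_⟩
  rcases u with _ | t | ⟨t, i, _ | j⟩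
  · simp
  · simp [tree, mid_mem_bistarSet]
  · simp only [leg_mem_bistarSet, reduceCtorEq, tree, Option.some_inj, exists_eq_right',
      cen_mem_bistarSet, false_or, iff_self_and]
    exact isSome_of_lt_legLength
  · simp only [leg_mem_bistarSet, reduceCtorEq, tree, Option.some_inj, exists_eq_right', false_or]
    grind

theorem segment_sdiff_segment (hj : j ≤ hi) :
    segment s i lo hi \ segment s i j hi = segment s i lo j := by
  ext v
  simp only [Finset.mem_sdiff, mem_segment]
  grind

theorem starSet_sdiff_segment (hj : j < x.legLength i) :
    starSet s x \ segment s i j (x.legLength i) = starSet s (x.setLeg i j) := by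
  ext v
  rcases v with _ | t | ⟨t, k, l⟩
  · simp [mid_notMem_starSet]
  · simp [cen_mem_starSet, mem_segment, isSome_setLeg]
  · simp only [Finset.mem_sdiff, leg_mem_starSet, leg_mem_segment, legLength_setLeg hj]
    grind

theorem bistarSet_sdiff_segment (hj : j < (p s).legLength i) :
    bistarSet p \ segment s i j ((p s).legLength i) =
      bistarSet (Function.update p s ((p s).setLeg i j)) := by
  ext v
  rcases v with _ | t | ⟨t, k, l⟩
  · simp [mid_mem_bistarSet, mem_segment]
  · simp only [Finset.mem_sdiff, cen_mem_bistarSet, mem_segment, reduceCtorEq, and_false,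
      exists_false, not_false_eq_true, and_true, Function.update_apply]
    grind [isSome_setLeg]
  · simp only [Finset.mem_sdiff, leg_mem_bistarSet, leg_mem_segment, Function.update_apply]
    grind [legLength_setLeg]

theorem bistarSet_sdiff_starSet :
    bistarSet p \ starSet s (p s) = bistarSet (Function.update p s none) := by
  ext v
  rcases v with _ | t | ⟨t, k, l⟩
  · simp [mid_mem_bistarSet, mid_notMem_starSet]
  · simp only [Finset.mem_sdiff, cen_mem_bistarSet, cen_mem_starSet, Function.update_apply]
    grind
  · simp only [Finset.mem_sdiff, leg_mem_bistarSet, leg_mem_starSet, Function.update_apply]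
    grind [legLength]

/-- `Realizes W P`: the set `W` of vertices induces a graph of shape `P`. -/
inductive Realizes : Finset BistarVertex → Shape → Prop
  | segment (s : Bool) (i lo hi : ℕ) : Realizes (segment s i lo hi) (.path (hi - lo))
  | star (s : Bool) (x : StarLengths) : Realizes (starSet s x) (.star x.shape)
  | bistar (p : Bool → StarLengths) : Realizes (bistarSet p) (.bistar fun s => (p s).shape)

/-- `Split W v A B`: removing the branch of `W` at `v` cuts `W` into parts of shapes `A` and `B`. -/
def Split (W : Finset BistarVertex) (v : BistarVertex) (A B : Shape) : Prop :=
  ∃ U, tree.IsBranch W v U ∧ Realizes U A ∧ Realizes (W \ U) B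

variable {W : Finset BistarVertex} {P A B : Shape}

theorem Realizes.bistar_update (p : Bool → StarLengths) (s : Bool) (x : StarLengths) :
    Realizes (bistarSet (Function.update p s x))
      (.bistar (Function.update (fun s => (p s).shape) s x.shape)) := by
  convert Realizes.bistar (Function.update p s x) with t
  rcases eq_or_ne t s with rfl | hts
  · rw [Function.update_self, Function.update_self]
  · rw [Function.update_of_ne hts, Function.update_of_ne hts]

theorem Realizes.card_eq (h : Realizes W P) : W.card = P.size := by
  cases h with
  | segment => exact card_segment
  | star => exact card_starSet
  | bistar => exact card_bistarSet

theorem isBranch_segment (h : lo < hi) :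
    tree.IsBranch (segment s i lo hi) (leg s i lo) (segment s i lo hi) :=
  isBranch_leg h fun k hk => by simp [leg_mem_segment, hk]

theorem isBranch_starSet (hx : x.isSome) :
    tree.IsBranch (starSet s x) (cen s) (starSet s x) :=
  isBranch_cen (by simp [cen_mem_starSet, hx]) hx fun i k => by simp [leg_mem_starSet]

theorem Realizes.exists_isBranch (h : Realizes W P) (hP : P.size ≠ 0) :
    ∃ v, tree.IsBranch W v W := by
  rw [← h.card_eq, Finset.card_ne_zero] at hP
  cases h with
  | segment s i lo hi =>
    obtain ⟨v, hv⟩ := hP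
    obtain ⟨j, hlo, hhi, -⟩ := mem_segment.1 hv
    exact ⟨_, isBranch_segment (hlo.trans_lt hhi)⟩
  | star s x =>
    rcases x with _ | L
    · exact absurd hP Finset.not_nonempty_empty
    · exact ⟨_, isBranch_starSet rfl⟩
  | bistar p => exact ⟨_, isBranch_mid⟩

theorem Realizes.rootUnique (h : Realizes W P) : tree.RootUnique W := by
  by_cases hP : P.size = 0
  · rw [← h.card_eq, Finset.card_eq_zero] at hP
    simp [hP, RootedForest.RootUnique]
  · obtain ⟨v, hv⟩ := h.exists_isBranch hP
    exact hv.rootUnique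

theorem Realizes.split_whole {v : BistarVertex} (h : Realizes W P) (hv : tree.IsBranch W v W) :
    Split W v P (.star none) :=
  ⟨W, hv, h, by rw [Finset.sdiff_self]; exact .star true none⟩

theorem split_segment (hlo : lo ≤ j) (hhi : j < hi) :
    Split (segment s i lo hi) (leg s i j) (.path (hi - j)) (.path (j - lo)) :=
  ⟨_, isBranch_leg hhi fun k hk => by simp [leg_mem_segment, hlo.trans hk], .segment ..,
    by rw [segment_sdiff_segment hhi.le]; exact .segment ..⟩

theorem split_starSet_leg (hj : j < x.legLength i) :
    Split (starSet s x) (leg s i j) (.path (x.legLength i - j)) (.star (x.setLeg i j).shape) :=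
  ⟨_, isBranch_leg hj fun k _ => by simp [leg_mem_starSet], .segment ..,
    by rw [starSet_sdiff_segment hj]; exact .star ..⟩

theorem split_bistarSet_leg (hj : j < (p s).legLength i) :
    Split (bistarSet p) (leg s i j) (.path ((p s).legLength i - j))
      (.bistar (Function.update (fun s => (p s).shape) s ((p s).setLeg i j).shape)) :=
  ⟨_, isBranch_leg hj fun k _ => leg_mem_bistarSet, .segment ..,
    by rw [bistarSet_sdiff_segment hj]; exact .bistar_update ..⟩

theorem split_bistarSet_cen (hs : (p s).isSome) :
    Split (bistarSet p) (cen s) (.star (p s).shape)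
      (.bistar (Function.update (fun s => (p s).shape) s none)) :=
  ⟨_, isBranch_cen (cen_mem_bistarSet.2 hs) hs fun i k => leg_mem_bistarSet, .star ..,
    by rw [bistarSet_sdiff_starSet]; exact .bistar_update p s none⟩

theorem Realizes.exists_cut {v : BistarVertex} (h : Realizes W P) (hv : v ∈ W) :
    ∃ A B, Shape.Cut P A B ∧ Split W v A B := by
  cases h with
  | segment s i lo hi =>
    obtain ⟨j, hlo, hhi, rfl⟩ := mem_segment.1 hv
    refine ⟨_, _, ?_, split_segment hlo hhi⟩
    convert Shape.Cut.path (n := hi - lo) (j := j - lo) (by omega) using 2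
    omega
  | star s x =>
    rcases v with _ | t | ⟨t, i, j⟩
    · exact absurd hv mid_notMem_starSet
    · obtain ⟨rfl, hx⟩ := cen_mem_starSet.1 hv
      exact ⟨_, _, .whole _, (Realizes.star _ x).split_whole (isBranch_starSet hx)⟩
    · obtain ⟨rfl, hj⟩ := leg_mem_starSet.1 hv
      obtain ⟨m, hm, hset⟩ := exists_shape_setLeg hj
      refine ⟨_, _, ?_, split_starSet_leg hj⟩
      rw [hm, hset]
      exact .starLeg m hj
  | bistar p =>
    rcases v with _ | s | ⟨s, i, j⟩
    · exact ⟨_, _, .whole _, (Realizes.bistar p).split_whole isBranch_mid⟩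
    · have hs := cen_mem_bistarSet.1 hv
      obtain ⟨L, hL⟩ := Option.isSome_iff_exists.1 hs
      exact ⟨_, _, .center (by rw [hL]; rfl), split_bistarSet_cen hs⟩
    · have hj := leg_mem_bistarSet.1 hv
      obtain ⟨m, hm, hset⟩ := exists_shape_setLeg hj
      refine ⟨_, _, ?_, split_bistarSet_leg hj⟩
      rw [hset]
      exact .bistarLeg hm hj

theorem Realizes.exists_split (h : Realizes W P) (hP : P.size ≠ 0) (hcut : Shape.Cut P A B) :
    ∃ v, Split W v A B := by
  cases hcut with
  | whole => exact (h.exists_isBranch hP).imp fun v hv => h.split_whole hv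
  | @path n j hj =>
    generalize hQ : Shape.path n = Q at h
    cases h with cases hQ
    | segment s i lo hi =>
      have := split_segment (s := s) (i := i) (Nat.le_add_left lo j) (Nat.add_lt_of_lt_sub hj)
      rw [Nat.add_sub_cancel, Nat.sub_add_eq, Nat.sub_right_comm] at this
      exact ⟨_, this⟩
  | @starLeg l j m hj =>
    generalize hQ : Shape.star (some (l ::ₘ m)) = Q at h
    cases h with try cases hQ
    | star s x =>
      obtain ⟨i, rfl, hset⟩ := exists_legLength_eq (Nat.zero_lt_of_lt hj) (Shape.star.inj hQ).symm
      rw [← hset]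
      exact ⟨_, split_starSet_leg hj⟩
  | @center p s m hs =>
    generalize hQ : Shape.bistar p = Q at h
    cases h with cases hQ
    | bistar p =>
      exact ⟨_, split_bistarSet_cen (by simpa [shape] using Option.isSome_of_eq_some hs)⟩
  | @bistarLeg p s l j m hs hj =>
    generalize hQ : Shape.bistar p = Q at h
    cases h with cases hQ
    | bistar p =>
      obtain ⟨i, rfl, hset⟩ := exists_legLength_eq (Nat.zero_lt_of_lt hj) hs
      rw [← hset]
      exact ⟨_, split_bistarSet_leg hj⟩

theorem Realizes.grundy_eq (h : Realizes W P) : grundy (OctalMove tree.graph) W = P.value := by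
  rw [← Shape.grundy_eq_value]
  refine grundy_eq_of_bisimulation (R := Realizes) (fun {W P W'} hP hmove => ?_)
    (fun {W P Q} hP hmove => ?_) h
  · rw [RootedForest.octalMove_graph_iff_isBranch hP.rootUnique] at hmove
    obtain ⟨v, U, hU, hmove⟩ := hmove
    obtain ⟨A, B, hcut, U', hU', hA, hB⟩ := hP.exists_cut hU.1
    obtain rfl := hU.eq hU'
    rw [hA.card_eq, hB.card_eq] at hmove
    rcases hmove with ⟨rfl, hsize⟩ | ⟨rfl, hsize⟩
    · exact ⟨A, ⟨A, B, hcut, .inl ⟨rfl, hsize⟩⟩, hA⟩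
    · exact ⟨B, ⟨A, B, hcut, .inr ⟨rfl, hsize⟩⟩, hB⟩
  · obtain ⟨A, B, hcut, hmove⟩ := hmove
    have hsize : P.size ≠ 0 := by rw [← hcut.size_add_size]; omega
    obtain ⟨v, U, hU, hA, hB⟩ := hP.exists_split hsize hcut
    simp only [RootedForest.octalMove_graph_iff_isBranch hP.rootUnique]
    rw [← hA.card_eq, ← hB.card_eq] at hmove
    rcases hmove with ⟨rfl, hsize⟩ | ⟨rfl, hsize⟩
    · exact ⟨U, ⟨v, U, hU, .inl ⟨rfl, hsize⟩⟩, hA⟩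
    · exact ⟨W \ U, ⟨v, U, hU, .inr ⟨rfl, hsize⟩⟩, hB⟩

end BistarVertex

namespace SubdividedStar

open BistarVertex

/-- The lengths of the paths of a subdivided star, in order. -/
def lengths : SubdividedStar → StarLengths
  | empty => none
  | star paths _ => some paths

/-- The class of a subdivided star, read off from its lengths modulo 3. -/
def cls (S : SubdividedStar) : StarClass := S.lengths.shape.cls

/-- The position of a vertex of a subdivided star placed on side `s` of the universal bistar. -/
def toTree : (S : SubdividedStar) → Bool → S.Vertex → BistarVertex
  | star _ _, s, none => cen s
  | star _ _, s, some ⟨i, j⟩ => leg s i j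

variable {S S' : SubdividedStar} {s t : Bool}

theorem toTree_injective : Function.Injective (S.toTree s) := by
  rcases S with _ | ⟨L, pos⟩
  · rintro ⟨⟩
  · rintro (_ | ⟨i, j⟩) (_ | ⟨i', j'⟩) h
    · rfl
    · nomatch h
    · nomatch h
    · obtain ⟨-, hi, hj⟩ := leg.inj h
      obtain rfl := Fin.ext hi
      obtain rfl := Fin.ext hj
      rfl

theorem toTree_ne_mid (v : S.Vertex) : S.toTree s v ≠ mid := by
  rcases S with _ | ⟨L, pos⟩
  · nomatch v
  · rcases v with _ | ⟨i, j⟩ <;> nofun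

theorem toTree_ne_toTree (h : s ≠ t) (u : S.Vertex) (v : S'.Vertex) :
    S.toTree s u ≠ S'.toTree t v := by
  rcases S with _ | ⟨L, pos⟩
  · nomatch u
  rcases S' with _ | ⟨L', pos'⟩
  · nomatch v
  rcases u with _ | ⟨i, j⟩ <;> rcases v with _ | ⟨i', j'⟩ <;> simp [toTree, h]

theorem parent_toTree_eq_mid (v : S.Vertex) :
    tree.parent (S.toTree s v) = some mid ↔ S.IsCenter v := by
  rcases S with _ | ⟨L, pos⟩
  · nomatch v
  · rcases v with _ | ⟨i, _ | j, hj⟩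
    · exact iff_of_true rfl rfl
    · exact iff_of_false nofun nofun
    · exact iff_of_false nofun nofun

theorem parent_toTree_eq_toTree (u v : S.Vertex) :
    tree.parent (S.toTree s v) = some (S.toTree s u) ↔ S.Step u v := by
  rcases S with _ | ⟨L, pos⟩
  · nomatch v
  · rcases v with _ | ⟨i, _ | j, hj⟩ <;> rcases u with _ | ⟨i', j', hj'⟩ <;>
      simp [toTree, tree, Step, eq_comm, Fin.ext_iff]

theorem parent_toTree_ne_toTree (h : s ≠ t) (u : S.Vertex) (v : S'.Vertex) :
    tree.parent (S.toTree s u) ≠ some (S'.toTree t v) := by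
  rcases S with _ | ⟨L, pos⟩
  · nomatch u
  rcases S' with _ | ⟨L', pos'⟩
  · nomatch v
  rcases u with _ | ⟨i, _ | j, hj⟩ <;> rcases v with _ | ⟨i', j'⟩ <;> simp [toTree, tree, h]

theorem range_toTree : Set.range (S.toTree s) = starSet s S.lengths := by
  rcases S with _ | ⟨L, pos⟩
  · exact Set.ext fun v => iff_of_false nofun (Finset.notMem_empty v)
  refine Set.Subset.antisymm ?_ fun v hv => ?_
  · rintro _ ⟨_ | ⟨i, j⟩, rfl⟩
    · exact cen_mem_starSet.2 ⟨rfl, rfl⟩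
    · exact leg_mem_starSet.2 ⟨rfl, j.2.trans_eq (List.getD_eq_getElem _ _ i.2).symm⟩
  · rcases v with _ | t | ⟨t, i, j⟩
    · exact absurd hv mid_notMem_starSet
    · exact ⟨none, congrArg cen (cen_mem_starSet.1 hv).1.symm⟩
    · obtain ⟨rfl, hj⟩ := leg_mem_starSet.1 hv
      obtain ⟨_, hi, ⟨⟩, hleg⟩ := StarLengths.exists_getElem_of_lt_legLength hj
      exact ⟨some ⟨⟨i, hi⟩, ⟨j, hj.trans_eq hleg⟩⟩, rfl⟩

theorem adj_toTree (u v : S.Vertex) :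
    tree.graph.Adj (S.toTree s u) (S.toTree s v) ↔ S.graph.Adj u v := by
  rw [RootedForest.graph, graph, SimpleGraph.fromRel_adj, SimpleGraph.fromRel_adj,
    toTree_injective.ne_iff, parent_toTree_eq_toTree, parent_toTree_eq_toTree, or_comm]

/-- A subdivided star as a subgraph of the universal bistar. -/
def graphEmbedding (S : SubdividedStar) : S.graph ↪g tree.graph where
  toFun := S.toTree true
  inj' := toTree_injective
  map_rel_iff' := adj_toTree _ _

/-- The position of a vertex of a subdivided bistar in the universal bistar. -/
def bistarToTree (S S' : SubdividedStar) : S.Vertex ⊕ Unit ⊕ S'.Vertex → BistarVertex :=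
  Sum.elim (S.toTree false) (Sum.elim (fun _ => mid) (S'.toTree true))

theorem bistarToTree_injective : Function.Injective (bistarToTree S S') := by
  have hright : Function.Injective (Sum.elim (fun _ : Unit => mid) (S'.toTree true)) :=
    (Function.injective_of_subsingleton _).sumElim toTree_injective
      fun _ v => (toTree_ne_mid v).symm
  refine toTree_injective.sumElim hright fun u v => ?_
  rcases v with _ | v
  · exact toTree_ne_mid u
  · exact toTree_ne_toTree Bool.false_ne_true u v

theorem range_bistarToTree :
    Set.range (bistarToTree S S') =
      bistarSet fun s => bif s then S'.lengths else S.lengths := by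
  rw [bistarToTree, Set.Sum.elim_range, Set.Sum.elim_range, range_toTree, range_toTree]
  ext v
  simp [bistarSet, or_comm]

theorem adj_bistarToTree (u v : S.Vertex ⊕ Unit ⊕ S'.Vertex) :
    tree.graph.Adj (bistarToTree S S' u) (bistarToTree S S' v) ↔ (S.bistar S').Adj u v := by
  have hsides (u : S.Vertex) (v : S'.Vertex) :=
    parent_toTree_ne_toTree Bool.false_ne_true u v
  have hsides' (u : S.Vertex) (v : S'.Vertex) :=
    parent_toTree_ne_toTree Bool.false_ne_true.symm v u
  have hmid : tree.parent mid = none := rfl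
  rw [bistar, SimpleGraph.fromRel_adj]
  rcases u with u | _ | u <;> rcases v with v | _ | v
  · refine (adj_toTree u v).trans ?_
    rw [BistarStep, BistarStep, S.graph.adj_comm v u, or_self, Sum.inl_injective.ne_iff]
    exact ⟨fun h => ⟨h.ne, h⟩, And.right⟩
  case inr.inr.inr.inr =>
    refine (adj_toTree u v).trans ?_
    rw [BistarStep, BistarStep, S'.graph.adj_comm v u, or_self, Sum.inr_injective.ne_iff,
      Sum.inr_injective.ne_iff]
    exact ⟨fun h => ⟨h.ne, h⟩, And.right⟩
  all_goals
    rw [RootedForest.graph_adj]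
    simp [bistarToTree, BistarStep, parent_toTree_eq_mid, hsides, hsides', hmid]

/-- A subdivided bistar as a subgraph of the universal bistar. -/
def bistarEmbedding (S S' : SubdividedStar) : S.bistar S' ↪g tree.graph where
  toFun := bistarToTree S S'
  inj' := bistarToTree_injective
  map_rel_iff' := adj_bistarToTree _ _

theorem value_eq (S : SubdividedStar) : S.value = S.cls.val := by
  have hW : Finset.univ.map S.graphEmbedding.toEmbedding = starSet true S.lengths := by
    rw [← Finset.coe_inj, Finset.coe_map, Finset.coe_univ, Set.image_univ]
    exact range_toTree
  rw [value, grundyValue, ← grundy_map S.graphEmbedding, hW, (Realizes.star ..).grundy_eq]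
  rfl

theorem grundyValue_bistar (S S' : SubdividedStar) :
    grundyValue (S.bistar S') = S.cls.val₂ S'.cls := by
  have hW : Finset.univ.map (S.bistarEmbedding S').toEmbedding =
      bistarSet fun s => bif s then S'.lengths else S.lengths := by
    rw [← Finset.coe_inj, Finset.coe_map, Finset.coe_univ, Set.image_univ]
    exact range_bistarToTree
  rw [grundyValue, ← grundy_map (S.bistarEmbedding S'), hW, (Realizes.bistar _).grundy_eq]
  rfl

end SubdividedStar

/-! ### The ten classes as sets of stars -/

namespace SubdividedStar

variable {paths : List ℕ} {pos : ∀ l ∈ paths, 1 ≤ l}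

theorem numTwo_star : (star paths pos).numTwo = StarShape.residueCount 2 paths := by
  rw [numTwo, List.count_eq_countP, List.countP_map, StarShape.residueCount, Multiset.coe_countP]
  congr 1

theorem reducesTo_star_iff {m : Multiset ℕ} (hm : ∀ r ∈ m, r = 1 ∨ r = 2) :
    (star paths pos).ReducesTo m ↔
      StarShape.residueCount 1 paths = m.count 1 ∧ StarShape.residueCount 2 paths = m.count 2 := by
  have hcount {r : ℕ} (hr : r ≠ 0) :
      ((paths.map (· % 3)).filter (· ≠ 0) : Multiset ℕ).count r =
        StarShape.residueCount r paths := by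
    rw [Multiset.coe_count, List.count_filter (by simpa using hr), List.count_eq_countP,
      List.countP_map, StarShape.residueCount, Multiset.coe_countP]
    congr 1
  rw [ReducesTo, Multiset.ext, ← hcount one_ne_zero, ← hcount two_ne_zero]
  refine ⟨fun h => ⟨h 1, h 2⟩, fun h r => ?_⟩
  by_cases hr : r = 1 ∨ r = 2
  · rcases hr with rfl | rfl
    exacts [h.1, h.2]
  · rw [Multiset.count_eq_zero_of_notMem fun h' => hr (hm r h'), Multiset.count_eq_zero,
      Multiset.mem_coe, List.mem_filter, List.mem_map]
    rintro ⟨⟨l, -, rfl⟩, hl⟩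
    have := of_decide_eq_true hl
    omega

theorem exists_cls_eq (c : StarClass) : ∃ S : SubdividedStar, S.cls = c := by
  cases c with
  | d0 => exact ⟨star [2, 2, 2, 2] (by simp), rfl⟩
  | d0s => exact ⟨empty, rfl⟩
  | d1 => exact ⟨star [2, 2, 2, 2, 1] (by simp), rfl⟩
  | d1s => exact ⟨star [] (by simp), rfl⟩
  | d1b => exact ⟨star [1, 1, 1] (by simp), rfl⟩
  | d2 => exact ⟨star [2, 2, 2, 2, 2] (by simp), rfl⟩
  | d2s => exact ⟨star [1] (by simp), rfl⟩
  | d2b => exact ⟨star [2, 1, 1] (by simp), rfl⟩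
  | d3 => exact ⟨star [2, 2, 2, 2, 2, 1] (by simp), rfl⟩
  | d3b => exact ⟨star [2, 1, 1, 1] (by simp), rfl⟩

theorem sim2_iff {S S' : SubdividedStar} : Sim2 S S' ↔ S.cls = S'.cls := by
  simp only [Sim2, gameEquiv_iff, grundyValue_bistar]
  refine ⟨fun h => StarClass.eq_of_val₂_eq fun d => ?_, fun h T => by rw [h]⟩
  obtain ⟨T, rfl⟩ := exists_cls_eq d
  exact h T

theorem equivalence_sim2 : Equivalence Sim2 where
  refl _ := sim2_iff.2 rfl
  symm h := sim2_iff.2 (sim2_iff.1 h).symm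
  trans h h' := sim2_iff.2 ((sim2_iff.1 h).trans (sim2_iff.1 h'))

end SubdividedStar

namespace StarClass

open SubdividedStar StarShape

/-- The classes with a star or a box. -/
def IsSpecial : StarClass → Prop
  | d0 | d1 | d2 | d3 => False
  | _ => True

/-- The defining conditions of the special classes, for a star with `a` paths of length 1 and `b`
paths of length 2 modulo 3. -/
def SpecialCounts (a b : ℕ) : StarClass → Prop
  | d0s => ((ofCounts a b).val = 0 ∧ (b = 0 ∨ b = 2)) ∨ (a = 0 ∧ b = 1)
  | d1s => (a = 0 ∧ b = 0) ∨ (a = 1 ∧ b = 1) ∨ (a = 0 ∧ b = 3)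
  | d1b => (ofCounts a b).val = 1 ∧ (b = 0 ∨ b = 2) ∧ ¬ (a = 0 ∧ b = 0)
  | d2s => (a = 1 ∧ b = 0) ∨ (a = 0 ∧ b = 2)
  | d2b => (ofCounts a b).val = 2 ∧ (b = 1 ∨ b = 3)
  | d3b => (ofCounts a b).val = 3 ∧ (b = 1 ∨ b = 3)
  | _ => False

theorem specialCounts_iff (a b : ℕ) (c : StarClass) :
    SpecialCounts a b c ↔ c.IsSpecial ∧ ofCounts a b = c := by
  rcases Nat.mod_two_eq_zero_or_one a with ha | ha <;>
    rcases Nat.mod_two_eq_zero_or_one b with hb | hb <;>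
    rcases a with _ | _ | a <;> rcases b with _ | _ | _ | _ | b <;>
    cases c <;> simp [SpecialCounts, IsSpecial, ofCounts, val, ha, hb]

theorem special_star_iff {paths : List ℕ} {pos : ∀ l ∈ paths, 1 ≤ l} (c : StarClass) :
    Special c (.star paths pos) ↔
      SpecialCounts (residueCount 1 paths) (residueCount 2 paths) c := by
  have hval : (star paths pos).value =
      (ofCounts (residueCount 1 paths) (residueCount 2 paths)).val := value_eq _
  cases c <;> simp [Special, SpecialCounts, hval, numTwo_star, reducesTo_star_iff]

theorem special_iff {S : SubdividedStar} (c : StarClass) :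
    Special c S ↔ c.IsSpecial ∧ S.cls = c := by
  rcases S with _ | ⟨paths, pos⟩
  · have hval : SubdividedStar.empty.value = 0 := value_eq _
    cases c <;> simp [Special, numTwo, ReducesTo, IsSpecial, hval, SubdividedStar.cls, lengths,
      StarShape.cls, StarLengths.shape]
  · rw [special_star_iff, specialCounts_iff]
    rfl

theorem mem_stars_iff {c : StarClass} {S : SubdividedStar} : S ∈ c.stars ↔ S.cls = c := by
  have hplain : (∀ c, ¬ Special c S) ↔ ¬ S.cls.IsSpecial := by
    simp only [special_iff, not_and', forall_eq']
  cases c <;> simp only [stars, Set.mem_ofPred_eq, hplain] <;>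
    simp only [special_iff, value_eq] <;> cases S.cls <;> simp [val, IsSpecial]

theorem stars_injective : Function.Injective stars := by
  intro c c' h
  obtain ⟨S, rfl⟩ := exists_cls_eq c
  exact mem_stars_iff.1 (h ▸ mem_stars_iff.2 rfl)

theorem stars_cls (S : SubdividedStar) : S.cls.stars = {T | Sim2 T S} := by
  ext T
  rw [mem_stars_iff, Set.mem_ofPred_eq, sim2_iff]

theorem classes_sim2 :
    Setoid.classes ⟨Sim2, equivalence_sim2⟩ = Set.range stars := by
  ext A
  constructor
  · rintro ⟨S, rfl⟩
    exact ⟨S.cls, stars_cls S⟩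
  · rintro ⟨c, rfl⟩
    obtain ⟨S, rfl⟩ := exists_cls_eq c
    exact ⟨S, stars_cls S⟩

end StarClass

theorem mainTheorem5 :
    (∃ h : Equivalence SubdividedStar.Sim2,
      Setoid.classes ⟨SubdividedStar.Sim2, h⟩ = Set.range StarClass.stars ∧
      Function.Injective StarClass.stars) ∧
    (∀ (c c' : StarClass) (S S' : SubdividedStar), S ∈ c.stars → S' ∈ c'.stars →
      grundyValue (S.bistar S') = StarClass.table c c' S.value S'.value) := by
  refine ⟨⟨SubdividedStar.equivalence_sim2, StarClass.classes_sim2, StarClass.stars_injective⟩, ?_⟩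
  intro c c' S S' hS hS'
  obtain rfl := StarClass.mem_stars_iff.1 hS
  obtain rfl := StarClass.mem_stars_iff.1 hS'
  rw [SubdividedStar.grundyValue_bistar, S.value_eq, S'.value_eq, StarClass.val₂]
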